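/- **Setting.** Let $(X,A,Y)\sim P$ with $X\in\mathcal X$, $A\in\{0,1\}$, $Y\in\mathcal Y\subseteq[0,1]$; let $\mathcal F$ be a class of measurable $f:\mathcal X\to[0,1]$ and $l:\mathcal Y\times[0,1]\to[0,1]$ be $1$-Lipschitz in the $\ell_1$-norm, with $l(y,u):=l(y,1)$ for $u>1$. Let $\mathcal E_0,\mathcal E_1$ be measurable events in terms of $(A,Y)$ and $\beta_0,\beta_1\in\mathbb R$, with $P(\mathcal E_a)>0$ whenever $\beta_a\ne0$. Put $\mathrm{loss}(f)=E[l(Y,f(X))]$, $\mathrm{disparity}(f)=\sum_{a}\beta_aE[f(X)\mid\mathcal E_a]$, and extend both linearly to discrete distributions $Q$ on $\mathcal F$. For $\varepsilon\ge0$ call $\tilde Q$ *feasible* if $\mathrm{loss}(\tilde Q)\le\varepsilon$; the disparity-range problem minimizes $\mathrm{disparity}$ over feasible distributions. Let $h_f(x,z)=1\{f(x)\ge z\}$ for $z\in[0,1]$ and $\mathcal H=\{h_f:f\in\mathcal F\}$. Its Rademacher complexity is $R_m(\mathcal H)=\sup_{u_1,\dots,u_m\in\mathcal X\times[0,1]}E_\sigma\sup_{h\in\mathcal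 H}\big|\tfrac1m\sum_i\sigma_ih(u_i)\big|$, with independent uniform signs $\sigma_i$. For every $z\in[0,1]$ the class $\{h_f(\cdot,z)\}$ is assumed measurable for the law of $X$: for all $m$ and $s\in\mathbb R^m$, $x\mapsto\sup_f|\sum_is_ih_f(x_i,z)|$ is measurable with respect to the completed $m$-fold product law. **Sample problem.** Given $n$ i.i.d. observations, let $n_a$ be the number of them in $\mathcal E_a$. For an integer $N\ge1$ let $\alpha=1/N$, let $Z$ be uniform on $\{\alpha,2\alpha,\dots,1\}$, independent of the data, let $\underline y$ be the smallest element within $\alpha/2$ of $y$ in a given finite $\alpha/2$-cover of $\mathcal Y$ by points of $\mathcal Y$, and let $c(y,z)=N\big(l(y,z+\tfrac\alpha2)-l(y,z-\tfrac\alpha2)\big)$. Write $\hat E$ for the sample average and $\hat E[\,\cdot\mid\mathcal E_a]$ for the average over the observations in $\mathcal E_a$ ($0$ if there are none). Put $\widehat{\mathrm{cost}}(h)=\hat E\,E_Z[c(\underline Y,Z)h(X,Z)]$, $\widehat{\mathrm{disp}}(h)=\sum_a\beta_a\hat E[E_Zh(X,Z)\mid\mathcal E_a]$, $\hat c_0=\hat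 E[l(\underline Y,\tfrac\alpha2)]$, and extend the first two linearly to distributions $Q$ on $\mathcal H$ (equivalently on $\mathcal F$, since $f\mapsto h_f$ is injective). Let $L(Q,\lambda)=\widehat{\mathrm{disp}}(Q)+\lambda(\widehat{\mathrm{cost}}(Q)-\hat\varepsilon)$ for the tolerance $\hat\varepsilon$ below. **Algorithm** (exponentiated gradient, with parameters $B_\lambda,\nu$ and learning rate $\eta=\nu/(2\rho^2B_\lambda)$, where $\rho=\sup_{h\in\mathcal H}|\widehat{\mathrm{cost}}(h)-\hat\varepsilon|$; if $\rho=0$, put $\eta=0$). Put $\theta_1=0$. In iteration $t=1,2,\dots$ let $\lambda_t=B_\lambda e^{\theta_t}/(1+e^{\theta_t})$, let $h_t$ be a minimizer of $L(\cdot,\lambda_t)$ over $\mathcal H$ supplied by an exact oracle, and let $\hat Q_t$ be the uniform mixture of $h_1,\dots,h_t$ and $\hat\lambda_t$ the average of $\lambda_1,\dots,\lambda_t$. Let $\nu_t=\max\{L(\hat Q_t,\hat\lambda_t)-\min_hL(h,\hat\lambda_t),\ \max_{0\le\lambda\le B_\lambda}L(\hat Q_t,\lambda)-L(\hat Q_t,\hat\lambda_t)\}$.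 If $\nu_t\le\nu$, stop, and return $\hat Q_t$ if $\widehat{\mathrm{cost}}(\hat Q_t)\le\hat\varepsilon+(|\beta_0|+|\beta_1|+2\nu)/B_\lambda$, and null otherwise. If $\nu_t>\nu$, put $\theta_{t+1}=\theta_t+\eta(\widehat{\mathrm{cost}}(h_t)-\hat\varepsilon)$. **Theorem.** Let $0\le\phi\le\frac12$, $C>0$, $b\in\mathbb R$ and $\kappa_\nu,\kappa_B,\kappa_N>0$. There are a constant $K>0$ and an integer $p\ge0$, depending only on these numbers, such that the following holds for every setting as above with $|\beta_0|+|\beta_1|\le b$ and $R_m(\mathcal H)\le Cm^{-\phi}$ for all $m\ge1$, for all $n\ge1$ and $\delta\in(0,1)$. Let $\nu=\kappa_\nu n^{-\phi}$, $B_\lambda=\kappa_Bn^{\phi}$, and let $N$ be an integer with $\frac{n^\phi}{2C+2}\le N\le\kappa_Nn^\phi$. Let $$\hat\varepsilon=\varepsilon-\hat c_0+C'n^{-\phi}-C''n^{-1/2},\qquad C''\ge b_\delta:=\sqrt{\tfrac{-\ln(\delta/8)}2},\qquad C'\ge2C+2+\sqrt{2\ln(8N/\delta)}+(C''-b_\delta).$$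 Then on every sample the algorithm stops after at most $K\,(1+\varepsilon+C'n^{-\phi}+C''n^{-1/2})^2\,n^{4\phi}$ iterations, that is, after $O(n^{4\phi})$ iterations as long as $\varepsilon$, $C'n^{-\phi}$ and $C''n^{-1/2}$ stay bounded. With $\Lambda=K\,(1+\ln n+\ln(1/\delta))^p$, with probability at least $1-\delta$ one of the following holds: 1. the output is a distribution $\hat Q$ with $\mathrm{loss}(\hat Q)\le\varepsilon+(C'+\Lambda)\,n^{-\phi}$, and, provided $n_a>0$ for each $a$ with $\beta_a\neq0$, $\mathrm{disparity}(\hat Q)\le\mathrm{disparity}(\tilde Q)+\Lambda n_0^{-\phi}+\Lambda n_1^{-\phi}$ for every feasible $\tilde Q$ (if $n_a=0$ and $\beta_a=0$, the term with $n_a$ may be omitted when $\phi>0$, and is $\Lambda$ when $\phi=0$); 2. the output is null and no feasible $\tilde Q$ exists. -/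

import Mathlib

open MeasureTheory ProbabilityTheory Set

universe u

namespace FairRashomon

noncomputable section

/-- Expectation of a real function `g` under a discrete distribution `Q`: `∑ i, Q i * g i`. -/
def mean {ι : Type*} (Q : PMF ι) (g : ι → ℝ) : ℝ := ∑' i, (Q i).toReal * g i

/-! ### Complexity and measurability of function classes -/

/-- Rademacher complexity
`R_n(G) = sup_{u_1, …, u_n} E_σ [ sup_{g ∈ G} |n⁻¹ ∑ i, σ_i g(u_i)| ]`,
the signs `σ_i` being independent and uniform on `{-1, 1}`. -/
def rademacherComplexity {U : Type*} (G : Set (U → ℝ)) (n : ℕ) : ℝ :=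
  ⨆ u : Fin n → U, (∑ σ : Fin n → ℤˣ,
    ⨆ g : G, |(∑ i, ((σ i : ℤ) : ℝ) * g.1 (u i)) / n|) / 2 ^ n

/-- `G` is a `μ`-measurable class: for all `m` and all `s ∈ ℝ^m` the function
`x ↦ sup_{g ∈ G} |∑ i, s_i g(x_i)|` is measurable for the completion of `μ^m`. -/
def MeasurableClass {𝒳 : Type*} [MeasurableSpace 𝒳] (G : Set (𝒳 → ℝ)) (μ : Measure 𝒳) : Prop :=
  ∀ (m : ℕ) (s : Fin m → ℝ),
    AEMeasurable (fun x : Fin m → 𝒳 => ⨆ g : G, |∑ i, s i * g.1 (x i)|)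
      (Measure.pi fun _ : Fin m => μ)

/-- The threshold classifier `h_f(x, z) = 1{f(x) ≥ z}`. -/
def threshold {𝒳 : Type*} (f : 𝒳 → unitInterval) (x : 𝒳) (z : ℝ) : ℝ :=
  if z ≤ (f x : ℝ) then 1 else 0

/-- The class `ℋ = {h_f : f ∈ ℱ}` of threshold classifiers, as functions on `𝒳 × [0, 1]`. -/
def thresholdClass {𝒳 : Type*} (ℱ : Set (𝒳 → unitInterval)) : Set (𝒳 × unitInterval → ℝ) :=
  (fun f u => threshold f u.1 (u.2 : ℝ)) '' ℱ

/-! ### The population problem -/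

/-- The setting: law of `(X, A, Y*)`, predictors, loss, disparity measure and loss tolerance. -/
structure Setting (𝒳 : Type u) [MeasurableSpace 𝒳] where
  /-- the outcome space `𝒴 ⊆ [0, 1]` -/
  outcomes : Set ℝ
  outcomes_subset : outcomes ⊆ Icc 0 1
  /-- the joint law of features, sensitive attribute and outcome -/
  law : Measure (𝒳 × Fin 2 × outcomes)
  law_prob : IsProbabilityMeasure law
  /-- the class `ℱ` of prediction functions -/
  predictors : Set (𝒳 → unitInterval)
  predictors_measurable : ∀ f ∈ predictors, Measurable f
  /-- the loss function `l : 𝒴 × [0, 1] → [0, 1]` -/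
  ell : outcomes → unitInterval → unitInterval
  ell_lipschitz : ∀ y u y' u',
    |(ell y u : ℝ) - ell y' u'| ≤ |(y : ℝ) - y'| + |(u : ℝ) - u'|
  /-- the conditioning events, depending on attribute and outcome -/
  event : Fin 2 → Set (Fin 2 × outcomes)
  event_measurable : ∀ a, MeasurableSet (event a)
  /-- the coefficients of the disparity measure -/
  β : Fin 2 → ℝ
  event_pos : ∀ a, β a ≠ 0 → law {o | o.2 ∈ event a} ≠ 0
  /-- the loss tolerance `ε` -/
  tol : ℝ
  tol_nonneg : 0 ≤ tol

namespace Setting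

variable {𝒳 : Type u} [MeasurableSpace 𝒳] (S : Setting 𝒳)

/-- One observation `(X_i, A_i, Y_i)`. -/
abbrev Obs : Type u := 𝒳 × Fin 2 × S.outcomes

/-- `loss(f) = E[l(Y, f(X))]`. -/
def loss (f : S.predictors) : ℝ := ∫ o, (S.ell o.2.2 (f.1 o.1) : ℝ) ∂S.law

/-- `disparity(f) = β₀ E[f(X) | 𝓔₀] + β₁ E[f(X) | 𝓔₁]`. -/
def disparity (f : S.predictors) : ℝ :=
  ∑ a, S.β a * ∫ o, (f.1 o.1 : ℝ) ∂(ProbabilityTheory.cond S.law {o | o.2 ∈ S.event a})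

/-- `Q` is feasible in the disparity range problem: `loss(Q) ≤ ε`. -/
def Feasible (Q : PMF S.predictors) : Prop := mean Q S.loss ≤ S.tol

/-- The law of `n` independent observations. -/
def sampleLaw (n : ℕ) : Measure (Fin n → S.Obs) := Measure.pi fun _ => S.law

/-! ### The discretized sample problem

`N` is the grid size, `α = 1/N`, the grid is `{j/N : j = 1, …, N}`, and `cov` is the finite
cover of the outcome space. -/

/-- `l(y, u)` for real `u`; arguments beyond the ends of `[0, 1]` are moved to the end. -/
def ellAt (y : S.outcomes) (u : ℝ) : ℝ := S.ell y (Set.projIcc 0 1 zero_le_one u)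

/-- `cov` is an `α/2`-cover of the outcome space. -/
def IsCover (N : ℕ) (cov : Finset S.outcomes) : Prop :=
  ∀ y : S.outcomes, ∃ y' ∈ cov, |(y : ℝ) - y'| ≤ 1 / (2 * (N : ℝ))

open Classical in
/-- The smallest element of the cover at distance at most `α/2` from `y`. -/
def lower (N : ℕ) (cov : Finset S.outcomes) (y : S.outcomes) : S.outcomes :=
  let near : Finset S.outcomes :=
    Finset.filter (fun y' : S.outcomes => |(y : ℝ) - y'| ≤ 1 / (2 * (N : ℝ))) cov
  if h : near.Nonempty then near.min' h else y

/-- `c(y, z) = N (l(y, z + α/2) - l(y, z - α/2))`. -/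
def c (N : ℕ) (y : S.outcomes) (z : ℝ) : ℝ :=
  N * (S.ellAt y (z + 1 / (2 * (N : ℝ))) - S.ellAt y (z - 1 / (2 * (N : ℝ))))

/-- Empirical cost of `h_f`: the sample average of `E_Z[c(y̲, Z) h_f(x, Z)]`, `Z` uniform on the
grid. -/
def empCost {n : ℕ} (N : ℕ) (cov : Finset S.outcomes) (ω : Fin n → S.Obs)
    (f : S.predictors) : ℝ :=
  (∑ i, (∑ j ∈ Finset.Icc 1 N,
    S.c N (S.lower N cov (ω i).2.2) ((j : ℝ) / N) * threshold f.1 (ω i).1 ((j : ℝ) / N)) / N) / n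

/-- The empirical constant `ĉ₀`: the sample average of `l(y̲, α/2)`. -/
def empC0 {n : ℕ} (N : ℕ) (cov : Finset S.outcomes) (ω : Fin n → S.Obs) : ℝ :=
  (∑ i, S.ellAt (S.lower N cov (ω i).2.2) (1 / (2 * (N : ℝ)))) / n

open Classical in
/-- The observations in the sample that satisfy the conditioning event `𝓔_a`. -/
def group {n : ℕ} (ω : Fin n → S.Obs) (a : Fin 2) : Finset (Fin n) :=
  Finset.univ.filter fun i => (ω i).2 ∈ S.event a

/-- Empirical disparity of `h_f`: `∑ a, β_a Ê[h_f(X, Z) | 𝓔_a]`, `Z` uniform on the grid.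
The average over an empty group is `0`. -/
def empDisparity {n : ℕ} (N : ℕ) (ω : Fin n → S.Obs) (f : S.predictors) : ℝ :=
  ∑ a, S.β a * ((∑ i ∈ S.group ω a,
    (∑ j ∈ Finset.Icc 1 N, threshold f.1 (ω i).1 ((j : ℝ) / N)) / N) / (S.group ω a).card)

end Setting

/-! ### The exponentiated gradient algorithm

The classifiers `h_f` are indexed by `ι`; the map `f ↦ h_f` is injective, so distributions over
classifiers are distributions over predictors. -/

/-- Input of the algorithm: empirical disparity and cost of each classifier, the weight
`|β₀| + |β₁|`, the tolerance `ε̂`, the bound `B`, the accuracy `ν`, the learning rate `η`, and the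
best-response oracle of the primal player. -/
structure EGInput (ι : Type*) where
  disp : ι → ℝ
  cost : ι → ℝ
  weight : ℝ
  epsHat : ℝ
  B : ℝ
  ν : ℝ
  η : ℝ
  best : ℝ → ι

namespace EGInput

variable {ι : Type*} (I : EGInput ι)

/-- The Lagrangian `L(Q, lam) = disp(Q) + lam (cost(Q) - ε̂)`. -/
def lagrangian (Q : PMF ι) (lam : ℝ) : ℝ :=
  mean Q I.disp + lam * (mean Q I.cost - I.epsHat)

/-- The oracle returns minimizers over the classifiers of the Lagrangian at every multiplier
in `[0, B]`. -/
def IsBestResponse : Prop :=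
  ∀ lam ∈ Icc 0 I.B, ∀ i, I.lagrangian (PMF.pure (I.best lam)) lam ≤
    I.lagrangian (PMF.pure i) lam

/-- `B exp(θ) / (1 + exp(θ))`. -/
def multiplier (θ : ℝ) : ℝ := I.B * (Real.exp θ / (1 + Real.exp θ))

/-- The parameter `θ` in iteration `k + 1`. -/
def theta : ℕ → ℝ
  | 0 => 0
  | k + 1 => theta k + I.η * (I.cost (I.best (I.multiplier (theta k))) - I.epsHat)

/-- The multiplier in iteration `k + 1`. -/
def lam (k : ℕ) : ℝ := I.multiplier (I.theta k)

/-- The average of the multipliers of iterations `1, …, k + 1`. -/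
def lamAvg (k : ℕ) : ℝ := (∑ s ∈ Finset.range (k + 1), I.lam s) / (k + 1)

/-- The uniform mixture of the best responses of iterations `1, …, k + 1`. -/
def mix (k : ℕ) : PMF ι :=
  (PMF.uniformOfFintype (Fin (k + 1))).map fun s => I.best (I.lam s)

/-- The best response of the dual player. -/
def bestLam (Q : PMF ι) : ℝ := if mean Q I.cost - I.epsHat ≤ 0 then 0 else I.B

/-- The duality gap `ν_t` in iteration `t = k + 1`. -/
def gap (k : ℕ) : ℝ :=
  max (I.lagrangian (I.mix k) (I.lamAvg k)
        - I.lagrangian (PMF.pure (I.best (I.lamAvg k))) (I.lamAvg k))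
      (I.lagrangian (I.mix k) (I.bestLam (I.mix k)) - I.lagrangian (I.mix k) (I.lamAvg k))

open Classical in
/-- The algorithm stops in iteration `T` and returns `out`, where `none` stands for null. -/
def Returns (T : ℕ) (out : Option (PMF ι)) : Prop :=
  ∃ k, T = k + 1 ∧ I.gap k ≤ I.ν ∧ (∀ j < k, I.ν < I.gap j) ∧
    out = if mean (I.mix k) I.cost ≤ I.epsHat + (I.weight + 2 * I.ν) / I.B
      then some (I.mix k) else none

end EGInput

/-- The input of the algorithm for the sample `ω`, with learning rate `η = ν / (2 ρ² B)`, where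
`ρ = sup_h |cost(h) - ε̂|`. -/
def Setting.egInput {𝒳 : Type u} [MeasurableSpace 𝒳] (S : Setting 𝒳) {n : ℕ} (N : ℕ)
    (cov : Finset S.outcomes) (B ν epsHat : ℝ) (best : ℝ → S.predictors)
    (ω : Fin n → S.Obs) : EGInput S.predictors where
  disp := S.empDisparity N ω
  cost := S.empCost N cov ω
  weight := |S.β 0| + |S.β 1|
  epsHat := epsHat
  B := B
  ν := ν
  η := ν / (2 * (⨆ f : S.predictors, |S.empCost N cov ω f - epsHat|) ^ 2 * B)
  best := best

/-- The empirical tolerance `ε̂ = ε - ĉ₀ + C' n^(-φ) - C'' n^(-1/2)`. -/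
def Setting.epsHat {𝒳 : Type u} [MeasurableSpace 𝒳] (S : Setting 𝒳) {n : ℕ} (N : ℕ)
    (cov : Finset S.outcomes) (φ C' C'' : ℝ) (ω : Fin n → S.Obs) : ℝ :=
  S.tol - S.empC0 N cov ω + C' * (n : ℝ) ^ (-φ) - C'' * (n : ℝ) ^ (-(1 / 2) : ℝ)

/-- The guarantee for the output of the algorithm: either it is a distribution `Q̂` with
`loss(Q̂) ≤ ε + errLoss` and `disparity(Q̂) ≤ disparity(Q̃) + errGroup (n₀^(-φ) + n₁^(-φ))` for all
feasible `Q̃`, or it is null and the population problem is infeasible. A group without observations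
gives no bound on the disparity if its coefficient is nonzero. -/
def Setting.Guarantee {𝒳 : Type u} [MeasurableSpace 𝒳] (S : Setting 𝒳) {n : ℕ}
    (φ errLoss errGroup : ℝ) (ω : Fin n → S.Obs) : Option (PMF S.predictors) → Prop
  | some Q =>
      mean Q S.loss ≤ S.tol + errLoss ∧
      ((∀ a, S.β a ≠ 0 → 0 < (S.group ω a).card) → ∀ Q' : PMF S.predictors, S.Feasible Q' →
        mean Q S.disparity ≤ mean Q' S.disparity
          + errGroup * ((S.group ω 0).card : ℝ) ^ (-φ)
          + errGroup * ((S.group ω 1).card : ℝ) ^ (-φ))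
  | none => ∀ Q' : PMF S.predictors, ¬ S.Feasible Q'

end

end FairRashomon

namespace FairRashomon

/-! ### Means under discrete distributions -/

section Mean

variable {ι : Type*} (Q : PMF ι)

/-! The proof joins a deterministic analysis of the game on the sample to a uniform law of large
numbers.

Game. The multiplier divided by `B` is the derivative at `θ` of the softplus function `log (1 + exp
θ)`, which therefore serves as a potential. Its second-order bound `log_one_add_exp_add_le`, summed
over the iterations, controls the regret of the dual player (`regret_le`). The primal player always
best-responds, so the duality gap is at most the average regret (`gap_le_regret`), and the learning
rate brings this below `ν` after `4 ρ² B² log 2 / ν²` iterations. At such a point disparity plus `B`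
times the constraint violation is at most `2ν` above the disparity of any distribution satisfying
the sample constraint (`disp_mix_add_le`). The output is thus nearly optimal on the sample. Since
sample disparities differ by at most `|β₀| + |β₁|`, its violation also passes the final test, unless
no distribution satisfies the sample constraint.

Discretization. The costs `c` are increments of the loss along the grid, so the cost of a threshold
classifier telescopes to the loss at a rounded prediction (`obsCost_add_ellAt`). The error is `1/N`,
of order `n^(-φ)`.

Uniform deviations. For one threshold, `measure_deviation_le` symmetrizes with a ghost sample at the
level of exponential moments and then applies bounded differences on the cube of signs. The weights
`c` lie in `[-1, 1]` and are removed by contraction (`sum_signedSup_mul_le`); a union bound covers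
the `N` thresholds. For the groups one conditions on the index set of the observations in the event:
given it, they are independent with the conditional law (`measure_subsample_le`).

Feasibility. No uniform bound is needed for the competitor. One near-optimal feasible distribution
is fixed before the sample is drawn, and Hoeffding's inequality shows that it satisfies the sample
constraint (`exists_nearOptimal`), because the tolerance contains slack for the grid error and for
the Hoeffding term. Off the exceptional event the output is compared with this distribution on the
sample, and the deviation bounds carry the comparison to the population. -/

lemma summable_pmf_toReal : Summable fun i => (Q i).toReal :=
  ENNReal.summable_toReal Q.tsum_coe_ne_top

lemma tsum_pmf_toReal : ∑' i, (Q i).toReal = 1 := by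
  rw [← ENNReal.tsum_toReal_eq fun i => Q.apply_ne_top i, Q.tsum_coe, ENNReal.toReal_one]

lemma summable_mean {g : ι → ℝ} {M : ℝ} (hg : ∀ i, |g i| ≤ M) :
    Summable fun i => (Q i).toReal * g i := by
  refine Summable.of_norm_bounded ((summable_pmf_toReal Q).mul_right M) fun i => ?_
  rw [Real.norm_eq_abs, abs_mul, abs_of_nonneg ENNReal.toReal_nonneg]
  exact mul_le_mul_of_nonneg_left (hg i) ENNReal.toReal_nonneg

lemma mean_const (c : ℝ) : mean Q (fun _ => c) = c := by
  rw [mean, tsum_mul_right, tsum_pmf_toReal, one_mul]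

lemma mean_const_mul (c : ℝ) (g : ι → ℝ) : mean Q (fun i => c * g i) = c * mean Q g := by
  rw [mean, mean, ← tsum_mul_left]
  exact tsum_congr fun i => by ring

lemma mean_add {g h : ι → ℝ} {M M' : ℝ} (hg : ∀ i, |g i| ≤ M) (hh : ∀ i, |h i| ≤ M') :
    mean Q (fun i => g i + h i) = mean Q g + mean Q h := by
  rw [mean, mean, mean, ← (summable_mean Q hg).tsum_add (summable_mean Q hh)]
  exact tsum_congr fun i => by ring

lemma mean_mono {g h : ι → ℝ} {M M' : ℝ} (hg : ∀ i, |g i| ≤ M) (hh : ∀ i, |h i| ≤ M')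
    (hgh : ∀ i, g i ≤ h i) : mean Q g ≤ mean Q h :=
  (summable_mean Q hg).tsum_le_tsum
    (fun i => mul_le_mul_of_nonneg_left (hgh i) ENNReal.toReal_nonneg) (summable_mean Q hh)

lemma abs_mean_le {g : ι → ℝ} {M : ℝ} (hg : ∀ i, |g i| ≤ M) : |mean Q g| ≤ M := by
  have hM : ∀ _ : ι, |M| ≤ |M| := fun _ => le_rfl
  have hM' : ∀ _ : ι, |-M| ≤ |M| := fun _ => (abs_neg M).le
  rw [abs_le]
  constructor
  · have := mean_mono Q hM' hg fun i => (abs_le.1 (hg i)).1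
    rwa [mean_const] at this
  · have := mean_mono Q hg hM fun i => (abs_le.1 (hg i)).2
    rwa [mean_const] at this

/-- Functions that differ by at most `t` have means that differ by at most `t`. -/
lemma mean_le_mean_add {g h : ι → ℝ} {M M' t : ℝ} (hg : ∀ i, |g i| ≤ M) (hh : ∀ i, |h i| ≤ M')
    (hgh : ∀ i, g i ≤ h i + t) : mean Q g ≤ mean Q h + t := by
  have ht : ∀ _ : ι, |t| ≤ |t| := fun _ => le_rfl
  have h1 : ∀ i, |h i + t| ≤ M' + |t| := fun i => (abs_add_le _ _).trans (by gcongr; exact hh i)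
  have := mean_mono Q hg h1 hgh
  rwa [mean_add Q hh ht, mean_const] at this

lemma mean_pure (i : ι) (g : ι → ℝ) : mean (PMF.pure i) g = g i := by
  classical
  rw [mean, tsum_eq_single i]
  · simp
  · intro j hj
    simp [PMF.pure_apply, hj]

lemma mean_map_uniformOfFintype (k : ℕ) (e : Fin (k + 1) → ι) (g : ι → ℝ) :
    mean ((PMF.uniformOfFintype (Fin (k + 1))).map e) g = (∑ s, g (e s)) / (k + 1) := by
  classical
  have h : ∀ i, (((PMF.uniformOfFintype (Fin (k + 1))).map e) i).toReal * g i
      = ∑ s, if i = e s then g (e s) / (k + 1) else 0 := by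
    intro i
    rw [PMF.map_apply, tsum_fintype, ENNReal.toReal_sum, Finset.sum_mul]
    · refine Finset.sum_congr rfl fun s _ => ?_
      split_ifs with his
      · subst his
        simp [div_eq_inv_mul]
        left
        rw [ENNReal.toReal_add (by simp) (by simp)]
        simp
      · simp
    · intro s _
      split_ifs <;> simp
  have hs : ∀ s, HasSum (fun i => if i = e s then g (e s) / ((k : ℝ) + 1) else 0)
      (g (e s) / ((k : ℝ) + 1)) := fun s => hasSum_ite_eq (e s) _
  rw [mean, tsum_congr h, (hasSum_sum fun s _ => hs s).tsum_eq, Finset.sum_div]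

end Mean

/-! ### Exponentiated gradient -/

lemma one_add_exp_pos (x : ℝ) : 0 < 1 + Real.exp x := by positivity

/-- The softplus function `log (1 + exp x)` has derivative `exp x / (1 + exp x)`. -/
lemma hasDerivAt_log_one_add_exp (x : ℝ) :
    HasDerivAt (fun x => Real.log (1 + Real.exp x)) (Real.exp x / (1 + Real.exp x)) x :=
  ((Real.hasDerivAt_exp x).const_add 1).log (one_add_exp_pos x).ne'

lemma hasDerivAt_exp_div_one_add_exp (x : ℝ) :
    HasDerivAt (fun x => Real.exp x / (1 + Real.exp x)) (Real.exp x / (1 + Real.exp x) ^ 2) x := by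
  have h := (Real.hasDerivAt_exp x).div ((Real.hasDerivAt_exp x).const_add 1) (one_add_exp_pos x).ne'
  rwa [show Real.exp x * (1 + Real.exp x) - Real.exp x * Real.exp x = Real.exp x by ring] at h

/-- The logistic function is `1`-Lipschitz. -/
lemma abs_exp_div_one_add_exp_sub_le (x y : ℝ) :
    |Real.exp x / (1 + Real.exp x) - Real.exp y / (1 + Real.exp y)| ≤ |x - y| := by
  have h := Convex.norm_image_sub_le_of_norm_hasDerivWithin_le (s := univ) (C := 1) (x := y) (y := x)
    (fun z _ => (hasDerivAt_exp_div_one_add_exp z).hasDerivWithinAt) (fun z _ => ?_)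
    convex_univ (mem_univ _) (mem_univ _)
  · simpa using h
  · have := Real.exp_pos z
    rw [Real.norm_eq_abs, abs_of_pos (by positivity), div_le_one (by positivity)]
    nlinarith

/-- By the mean value theorem the increment is `d` times the logistic function at a point within
`|d|` of `x`. As the logistic function is 1-Lipschitz, moving that point to `x` costs at most `d ^
2`. -/
lemma log_one_add_exp_add_le (x d : ℝ) :
    Real.log (1 + Real.exp (x + d)) ≤
      Real.log (1 + Real.exp x) + d * (Real.exp x / (1 + Real.exp x)) + d ^ 2 := by
  obtain rfl | hd := eq_or_ne d 0
  · simp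
  have key : ∃ z, |z - x| ≤ |d| ∧ Real.log (1 + Real.exp (x + d)) - Real.log (1 + Real.exp x)
      = d * (Real.exp z / (1 + Real.exp z)) := by
    rcases lt_or_gt_of_ne hd with h | h
    · obtain ⟨z, hz, hz'⟩ := exists_hasDerivAt_eq_slope _ _ (show x + d < x by linarith)
        (fun y _ => (hasDerivAt_log_one_add_exp y).continuousAt.continuousWithinAt)
        (fun y _ => hasDerivAt_log_one_add_exp y)
      refine ⟨z, ?_, ?_⟩
      · rw [abs_of_neg h, abs_of_neg (by linarith [hz.2])]; linarith [hz.1]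
      · rw [hz', sub_add_cancel_left, div_neg, mul_neg, mul_div_cancel₀ _ hd, neg_sub]
    · obtain ⟨z, hz, hz'⟩ := exists_hasDerivAt_eq_slope _ _ (show x < x + d by linarith)
        (fun y _ => (hasDerivAt_log_one_add_exp y).continuousAt.continuousWithinAt)
        (fun y _ => hasDerivAt_log_one_add_exp y)
      refine ⟨z, ?_, ?_⟩
      · rw [abs_of_pos h, abs_of_pos (by linarith [hz.1])]; linarith [hz.2]
      · rw [hz', add_sub_cancel_left, mul_div_cancel₀ _ hd]
  obtain ⟨z, hz, h⟩ := key
  have h1 := (abs_exp_div_one_add_exp_sub_le z x).trans hz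
  have h2 : d * (Real.exp z / (1 + Real.exp z) - Real.exp x / (1 + Real.exp x)) ≤ |d| * |d| :=
    (le_abs_self _).trans (by rw [abs_mul]; gcongr)
  rw [abs_mul_abs_self] at h2
  nlinarith

namespace EGInput

variable {ι : Type*} (I : EGInput ι)

lemma multiplier_mem (hB : 0 ≤ I.B) (θ : ℝ) : I.multiplier θ ∈ Icc 0 I.B := by
  have := Real.exp_pos θ
  refine ⟨by unfold multiplier; positivity, mul_le_of_le_one_right hB ?_⟩
  rw [div_le_one (by positivity)]
  linarith

lemma lam_mem (hB : 0 ≤ I.B) (k : ℕ) : I.lam k ∈ Icc 0 I.B := I.multiplier_mem hB _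

lemma lamAvg_mem (hB : 0 ≤ I.B) (k : ℕ) : I.lamAvg k ∈ Icc 0 I.B := by
  have hk : (0 : ℝ) < k + 1 := by positivity
  refine ⟨div_nonneg (Finset.sum_nonneg fun s _ => (I.lam_mem hB s).1) hk.le, ?_⟩
  rw [lamAvg, div_le_iff₀ hk]
  calc ∑ s ∈ Finset.range (k + 1), I.lam s ≤ ∑ s ∈ Finset.range (k + 1), I.B :=
        Finset.sum_le_sum fun s _ => (I.lam_mem hB s).2
    _ = I.B * (k + 1) := by simp; ring

lemma lagrangian_pure (i : ι) (l : ℝ) :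
    I.lagrangian (PMF.pure i) l = I.disp i + l * (I.cost i - I.epsHat) := by
  simp [lagrangian, mean_pure]

lemma mean_mix (k : ℕ) (g : ι → ℝ) :
    mean (I.mix k) g = (∑ s ∈ Finset.range (k + 1), g (I.best (I.lam s))) / (k + 1) := by
  have h : I.mix k
      = (PMF.uniformOfFintype (Fin (k + 1))).map fun s : Fin (k + 1) => I.best (I.lam s) :=
    PMF.map_comp _ _ _
  rw [h, mean_map_uniformOfFintype, Finset.sum_range]

/-- The Lagrangian is affine in the multiplier, so its maximum over `[0, B]` sits at an endpoint and
charges only a positive violation. -/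
lemma bestLam_mul (Q : PMF ι) : I.bestLam Q * (mean Q I.cost - I.epsHat)
    = I.B * max 0 (mean Q I.cost - I.epsHat) := by
  unfold bestLam
  split_ifs with h
  · rw [max_eq_left h]; ring
  · rw [max_eq_right (not_le.1 h).le]

/-- Regret bound of the dual player. -/
lemma regret_le {ρ : ℝ} (hρ : ∀ i, |I.cost i - I.epsHat| ≤ ρ) (hB : I.B ≠ 0) (k : ℕ) :
    Real.log (1 + Real.exp (I.theta k)) ≤ Real.log 2
      + I.η / I.B * ∑ s ∈ Finset.range k, I.lam s * (I.cost (I.best (I.lam s)) - I.epsHat)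
      + k * (I.η * ρ) ^ 2 := by
  induction k with
  | zero => simp [theta]; norm_num
  | succ k ih =>
    have h := log_one_add_exp_add_le (I.theta k) (I.η * (I.cost (I.best (I.lam k)) - I.epsHat))
    have h2 : (I.η * (I.cost (I.best (I.lam k)) - I.epsHat)) ^ 2 ≤ (I.η * ρ) ^ 2 := by
      rw [mul_pow, mul_pow]
      gcongr ?_ * ?_
      rw [← sq_abs]
      exact pow_le_pow_left₀ (abs_nonneg _) (hρ _) 2
    have h3 : I.η / I.B * (I.lam k * (I.cost (I.best (I.lam k)) - I.epsHat))
        = I.η * (I.cost (I.best (I.lam k)) - I.epsHat)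
          * (Real.exp (I.theta k) / (1 + Real.exp (I.theta k))) := by
      rw [show I.lam k = I.B * (Real.exp (I.theta k) / (1 + Real.exp (I.theta k))) from rfl]
      field_simp
    rw [Finset.sum_range_succ, mul_add, h3, show I.theta (k + 1)
      = I.theta k + I.η * (I.cost (I.best (I.lam k)) - I.epsHat) from rfl]
    push_cast
    linarith

lemma theta_eq (k : ℕ) : I.theta k
    = I.η * ∑ s ∈ Finset.range k, (I.cost (I.best (I.lam s)) - I.epsHat) := by
  induction k with
  | zero => simp [theta]
  | succ k ih =>
    rw [Finset.sum_range_succ, mul_add, ← ih]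
    rfl

/-- The duality gap is at most the average regret of the dual player. -/
lemma gap_le_regret (hbest : I.IsBestResponse) (hB : 0 ≤ I.B) (k : ℕ) :
    I.gap k ≤ (I.B * max 0 (∑ s ∈ Finset.range (k + 1), (I.cost (I.best (I.lam s)) - I.epsHat))
      - ∑ s ∈ Finset.range (k + 1), I.lam s * (I.cost (I.best (I.lam s)) - I.epsHat)) / (k + 1) := by
  have hk : (0 : ℝ) < k + 1 := by positivity
  set r : ℕ → ℝ := fun s => I.cost (I.best (I.lam s)) - I.epsHat with hr
  have hviol : mean (I.mix k) I.cost - I.epsHat = (∑ s ∈ Finset.range (k + 1), r s) / (k + 1) := by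
    rw [mean_mix, hr, Finset.sum_sub_distrib]
    simp
    field_simp
  -- average of the best response inequalities
  have h1 : I.lagrangian (I.mix k) 0 + (∑ s ∈ Finset.range (k + 1), I.lam s * r s) / (k + 1)
      ≤ I.lagrangian (PMF.pure (I.best (I.lamAvg k))) (I.lamAvg k) := by
    have h : ∀ s ∈ Finset.range (k + 1), I.disp (I.best (I.lam s)) + I.lam s * r s
        ≤ I.disp (I.best (I.lamAvg k)) + I.lam s * (I.cost (I.best (I.lamAvg k)) - I.epsHat) := by
      intro s _
      have := hbest (I.lam s) (I.lam_mem hB s) (I.best (I.lamAvg k))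
      rwa [lagrangian_pure, lagrangian_pure] at this
    have h' := Finset.sum_le_sum h
    rw [Finset.sum_add_distrib, Finset.sum_add_distrib, ← Finset.sum_mul] at h'
    rw [lagrangian_pure, lagrangian, mean_mix, zero_mul, add_zero, ← add_div, div_le_iff₀ hk]
    refine h'.trans (le_of_eq ?_)
    rw [lamAvg]
    simp
    field_simp
  have h2 : I.lagrangian (I.mix k) (I.bestLam (I.mix k)) = I.lagrangian (I.mix k) 0
      + I.B * max 0 (∑ s ∈ Finset.range (k + 1), r s) / (k + 1) := by
    rw [lagrangian, lagrangian, bestLam_mul, hviol, zero_mul, add_zero, mul_div_assoc,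
      ← max_div_div_right hk.le, zero_div]
  have h3 : I.lagrangian (PMF.pure (I.best (I.lamAvg k))) (I.lamAvg k)
      ≤ I.lagrangian (I.mix k) (I.lamAvg k) := by
    have h : ∀ s ∈ Finset.range (k + 1), I.lagrangian (PMF.pure (I.best (I.lamAvg k))) (I.lamAvg k)
        ≤ I.disp (I.best (I.lam s)) + I.lamAvg k * r s := by
      intro s _
      have := hbest (I.lamAvg k) (I.lamAvg_mem hB k) (I.best (I.lam s))
      rwa [lagrangian_pure I (I.best (I.lam s))] at this
    have h' := Finset.sum_le_sum h
    rw [Finset.sum_add_distrib, ← Finset.mul_sum, Finset.sum_const, Finset.card_range,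
      nsmul_eq_mul] at h'
    rw [show I.lagrangian (I.mix k) (I.lamAvg k) = _ + _ from rfl, hviol, mean_mix,
      mul_div_assoc', ← add_div, le_div_iff₀ hk]
    push_cast at h'
    linarith
  have h4 : I.lagrangian (I.mix k) (I.lamAvg k) ≤ I.lagrangian (I.mix k) (I.bestLam (I.mix k)) := by
    rw [lagrangian, lagrangian, bestLam_mul]
    have := I.lamAvg_mem hB k
    refine add_le_add_right ?_ _
    calc _ ≤ I.lamAvg k * max 0 (mean (I.mix k) I.cost - I.epsHat) :=
          mul_le_mul_of_nonneg_left (le_max_right _ _) this.1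
      _ ≤ _ := mul_le_mul_of_nonneg_right this.2 (le_max_left _ _)
  rw [gap, sub_div]
  -- Both gaps are nonnegative by `h3` and `h4`, so each is at most their sum; `h1` and `h2` bound
  -- the sum by the average regret.
  apply max_le <;> linarith

/-- The duality gap is at most `ν` after `4 ρ² B² log 2 / ν²` iterations. -/
lemma gap_le (hbest : I.IsBestResponse) {ρ : ℝ} (hρ : ∀ i, |I.cost i - I.epsHat| ≤ ρ)
    (hρ0 : 0 ≤ ρ) (hB : 0 < I.B) (hν : 0 < I.ν) (hη : I.η = I.ν / (2 * ρ ^ 2 * I.B)) (k : ℕ)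
    (hk : 4 * ρ ^ 2 * I.B ^ 2 * Real.log 2 / I.ν ^ 2 ≤ k + 1) : I.gap k ≤ I.ν := by
  refine (I.gap_le_regret hbest hB.le k).trans ?_
  have hk0 : (0 : ℝ) < k + 1 := by positivity
  -- For `ρ = 0` the learning rate is a division by zero, hence `0`, but then every violation
  -- vanishes and so does the regret.
  obtain rfl | hρ' := hρ0.eq_or_lt
  · have h0 : ∀ i, I.cost i - I.epsHat = 0 := fun i => abs_eq_zero.1 (le_antisymm (hρ i) (abs_nonneg _))
    simp [h0, hν.le]
  have hη' : 0 < I.η := by rw [hη]; positivity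
  have h := I.regret_le hρ hB.ne' (k + 1)
  set W := ∑ s ∈ Finset.range (k + 1), I.lam s * (I.cost (I.best (I.lam s)) - I.epsHat)
  set R := ∑ s ∈ Finset.range (k + 1), (I.cost (I.best (I.lam s)) - I.epsHat) with hR
  -- Softplus dominates the positive part, and `θ` is `η` times the accumulated violation `R`.
  have h1 : I.η * max 0 R ≤ Real.log (1 + Real.exp (I.theta (k + 1))) := by
    rw [theta_eq, ← hR]
    rcases max_cases 0 R with ⟨h, _⟩ | ⟨h, _⟩ <;> rw [h]
    · rw [mul_zero]
      exact Real.log_nonneg (by linarith [Real.exp_pos (I.η * R)])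
    · rw [Real.le_log_iff_exp_le (by positivity)]
      linarith
  have h2 := h1.trans h
  have h3 : I.B * max 0 R - W ≤ I.B / I.η * (Real.log 2 + (k + 1) * (I.η * ρ) ^ 2) := by
    have h4 : I.B * max 0 R - W = I.B / I.η * (I.η * max 0 R - I.η / I.B * W) := by field_simp
    rw [h4]
    gcongr
    push_cast at h2
    linarith
  rw [div_le_iff₀ hk0]
  refine h3.trans ?_
  rw [div_le_iff₀ (by positivity)] at hk
  -- The choice of `η` makes the quadratic term exactly half of the allowed `(k + 1) ν`; the
  -- hypothesis on `k` bounds the `log 2` term by the other half.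
  have h5 : I.B / I.η * (Real.log 2 + (k + 1) * (I.η * ρ) ^ 2)
      = (4 * ρ ^ 2 * I.B ^ 2 * Real.log 2) / (2 * I.ν) + (k + 1) * I.ν / 2 := by
    rw [hη]; field_simp; ring
  rw [h5]
  have h6 : (4 * ρ ^ 2 * I.B ^ 2 * Real.log 2) / (2 * I.ν) ≤ (k + 1) * I.ν / 2 := by
    rw [div_le_iff₀ (by positivity)]
    linarith
  linarith

/-- The algorithm stops, and the number of iterations is at most `4 ρ² B² log 2 / ν² + 1`. -/
lemma exists_returns (hbest : I.IsBestResponse) {ρ : ℝ} (hρ : ∀ i, |I.cost i - I.epsHat| ≤ ρ)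
    (hρ0 : 0 ≤ ρ) (hB : 0 < I.B) (hν : 0 < I.ν) (hη : I.η = I.ν / (2 * ρ ^ 2 * I.B)) :
    ∃ T out, I.Returns T out ∧ (T : ℝ) ≤ 4 * ρ ^ 2 * I.B ^ 2 * Real.log 2 / I.ν ^ 2 + 1 := by
  classical
  set x := 4 * ρ ^ 2 * I.B ^ 2 * Real.log 2 / I.ν ^ 2
  have hx : 0 ≤ x := by have := Real.log_nonneg one_le_two; positivity
  -- Index `k` is iteration `k + 1`, so `k = ⌊x⌋` already satisfies `x ≤ k + 1`.
  have hex : ∃ k, I.gap k ≤ I.ν := ⟨⌊x⌋₊, I.gap_le hbest hρ hρ0 hB hν hη _ (Nat.lt_floor_add_one x).le⟩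
  refine ⟨Nat.find hex + 1, _, ⟨Nat.find hex, rfl, Nat.find_spec hex,
    fun j hj => not_le.1 (Nat.find_min hex hj), rfl⟩, ?_⟩
  have h : Nat.find hex ≤ ⌊x⌋₊ :=
    Nat.find_min' hex (I.gap_le hbest hρ hρ0 hB hν hη _ (Nat.lt_floor_add_one x).le)
  have : (Nat.find hex : ℝ) ≤ x := (Nat.cast_le.2 h).trans (Nat.floor_le hx)
  push_cast
  linarith

/-- A `ν`-approximate saddle point is a `2ν`-optimal solution, up to a violation of the
constraint that is charged at the rate `B`. -/
lemma disp_mix_add_le (hbest : I.IsBestResponse) (hB : 0 ≤ I.B) {k : ℕ} (hgap : I.gap k ≤ I.ν)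
    {M M' : ℝ} (hdisp : ∀ i, |I.disp i| ≤ M) (hcost : ∀ i, |I.cost i| ≤ M') {Q : PMF ι}
    (hQ : mean Q I.cost ≤ I.epsHat) :
    mean (I.mix k) I.disp + I.B * max 0 (mean (I.mix k) I.cost - I.epsHat)
      ≤ mean Q I.disp + 2 * I.ν := by
  obtain ⟨h1, h2⟩ := max_le_iff.1 (show max _ _ ≤ _ from hgap)
  have hl := I.lamAvg_mem hB k
  set l := I.lamAvg k
  rw [show I.lagrangian (I.mix k) (I.bestLam (I.mix k)) = _ + _ from rfl, bestLam_mul] at h2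
  -- The oracle minimizes over single classifiers only; averaging its inequality over `Q` extends it
  -- to mixtures.
  have h3 : I.lagrangian (PMF.pure (I.best l)) l ≤ I.lagrangian Q l := by
    have hc : ∀ i, |l * I.cost i| ≤ l * M' := fun i => by
      rw [abs_mul, abs_of_nonneg hl.1]; exact mul_le_mul_of_nonneg_left (hcost i) hl.1
    have hm := mean_mono Q (g := fun _ => I.lagrangian (PMF.pure (I.best l)) l + l * I.epsHat)
      (fun _ => le_rfl) (fun i => (abs_add_le _ _).trans (add_le_add (hdisp i) (hc i)))
      (fun i => by
        have := hbest l hl i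
        rw [lagrangian_pure I i] at this
        linarith)
    rw [mean_const, mean_add Q hdisp hc, mean_const_mul] at hm
    rw [show I.lagrangian Q l = _ + _ from rfl]
    linarith
  have h4 : I.lagrangian Q l ≤ mean Q I.disp := by
    rw [lagrangian]
    nlinarith [hl.1]
  linarith

end EGInput

/-! ### Concentration on the cube -/

lemma sum_units_int (F : ℤˣ → ℝ) : ∑ ε, F ε = F 1 + F (-1) := by
  rw [UnitsInt.univ]
  exact Finset.sum_pair (by decide)

/-- One step of Hoeffding's lemma: factor out the midpoint and use `cosh x ≤ exp (x ^ 2 / 2)` with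
`x` at most `l` in absolute value. -/
lemma exp_add_exp_le {a b l : ℝ} (h : |a - b| ≤ 2) :
    Real.exp (l * a) + Real.exp (l * b) ≤ 2 * Real.exp (l * ((a + b) / 2) + l ^ 2 / 2) := by
  have h1 := Real.cosh_le_exp_half_sq (l * ((a - b) / 2))
  have h2 : Real.exp (l * a) + Real.exp (l * b)
      = 2 * (Real.exp (l * ((a + b) / 2)) * Real.cosh (l * ((a - b) / 2))) := by
    rw [Real.cosh_eq, mul_div_assoc', mul_add, ← Real.exp_add, ← Real.exp_add, mul_div_cancel₀ _ two_ne_zero]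
    congr 2 <;> ring
  rw [h2, Real.exp_add]
  have h3 : (l * ((a - b) / 2)) ^ 2 / 2 ≤ l ^ 2 / 2 := by
    have : ((a - b) / 2) ^ 2 ≤ 1 := by
      rw [sq_le_one_iff_abs_le_one, abs_div, abs_two]
      linarith
    rw [mul_pow]
    nlinarith [sq_nonneg l]
  gcongr
  exact h1.trans (Real.exp_le_exp.2 h3)

/-- Bounded differences inequality on `{-1, 1}^n`, for exponential moments. -/
lemma sum_exp_le_of_bounded_diff_fin : ∀ (n : ℕ) (F : (Fin n → ℤˣ) → ℝ) (l : ℝ),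
    (∀ σ i, |F σ - F (Function.update σ i (-σ i))| ≤ 2) →
    ∑ σ, Real.exp (l * F σ) ≤ 2 ^ n * Real.exp (l * ((∑ σ, F σ) / 2 ^ n) + n * l ^ 2 / 2)
  | 0, F, l, _ => by simp
  | n + 1, F, l, hF => by
    have split : ∀ G : (Fin (n + 1) → ℤˣ) → ℝ,
        ∑ σ, G σ = ∑ τ : Fin n → ℤˣ, (G (Fin.cons 1 τ) + G (Fin.cons (-1) τ)) := by
      intro G
      rw [← (Fin.consEquiv fun _ : Fin (n + 1) => ℤˣ).sum_comp, Fintype.sum_prod_type_right]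
      exact Finset.sum_congr rfl fun τ _ => sum_units_int _
    have h0 : ∀ τ : Fin n → ℤˣ, |F (Fin.cons 1 τ) - F (Fin.cons (-1) τ)| ≤ 2 := by
      intro τ
      have := hF (Fin.cons 1 τ) 0
      rwa [Fin.cons_zero, Fin.update_cons_zero] at this
    have h1 : ∀ ε : ℤˣ, ∀ (τ : Fin n → ℤˣ) i,
        |F (Fin.cons ε τ) - F (Fin.cons ε (Function.update τ i (-τ i)))| ≤ 2 := by
      intro ε τ i
      have := hF (Fin.cons ε τ) i.succ
      rwa [Fin.cons_succ, ← Fin.cons_update] at this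
    -- Averaging over the first sign preserves the bounded differences in the remaining ones and the
    -- overall mean.
    have ih := sum_exp_le_of_bounded_diff_fin n
      (fun τ => (F (Fin.cons 1 τ) + F (Fin.cons (-1) τ)) / 2) l (fun τ i => by
        have ha := abs_le.1 (h1 1 τ i)
        have hb := abs_le.1 (h1 (-1) τ i)
        rw [abs_le]
        constructor <;> linarith [ha.1, ha.2, hb.1, hb.2])
    rw [split, split]
    calc ∑ τ : Fin n → ℤˣ, (Real.exp (l * F (Fin.cons 1 τ)) + Real.exp (l * F (Fin.cons (-1) τ)))
        ≤ ∑ τ : Fin n → ℤˣ, 2 * Real.exp (l ^ 2 / 2)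
          * Real.exp (l * ((F (Fin.cons 1 τ) + F (Fin.cons (-1) τ)) / 2)) := by
          refine Finset.sum_le_sum fun τ _ => (exp_add_exp_le (h0 τ)).trans (le_of_eq ?_)
          rw [Real.exp_add]; ring
      _ ≤ 2 * Real.exp (l ^ 2 / 2) * (2 ^ n * Real.exp
          (l * ((∑ τ : Fin n → ℤˣ, (F (Fin.cons 1 τ) + F (Fin.cons (-1) τ)) / 2) / 2 ^ n)
            + n * l ^ 2 / 2)) := by
          rw [← Finset.mul_sum]
          exact mul_le_mul_of_nonneg_left ih (by positivity)
      _ = _ := by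
          rw [← Finset.sum_div, show ∀ a b c : ℝ, 2 * a * (b * c) = 2 * b * (a * c) by intros; ring,
            ← Real.exp_add, pow_succ' (2 : ℝ) n]
          congr 2
          push_cast
          field_simp
          ring

/-- The arbitrary index type is needed for subsamples, which are indexed by a subtype. -/
lemma sum_exp_le_of_bounded_diff {κ : Type*} [Fintype κ] [DecidableEq κ] (F : (κ → ℤˣ) → ℝ) (l : ℝ)
    (hF : ∀ σ i, |F σ - F (Function.update σ i (-σ i))| ≤ 2) :
    ∑ σ, Real.exp (l * F σ) ≤ 2 ^ Fintype.card κ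
      * Real.exp (l * ((∑ σ, F σ) / 2 ^ Fintype.card κ) + Fintype.card κ * l ^ 2 / 2) := by
  let e := (Fintype.equivFin κ).symm.arrowCongr (Equiv.refl ℤˣ)
  have h := sum_exp_le_of_bounded_diff_fin _ (fun σ => F (e σ)) l (fun σ i => by
    convert hF (e σ) ((Fintype.equivFin κ).symm i) using 4
    ext j
    simp [e, Function.update_apply, Equiv.eq_symm_apply])
  rwa [e.sum_comp fun σ => Real.exp (l * F σ), e.sum_comp] at h

/-! ### Suprema of signed sums -/

/-- `sup_f |∑ i, σ_i a_f(i)|`. -/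
noncomputable def signedSup {ι κ : Type*} [Fintype κ] (a : ι → κ → ℝ) (σ : κ → ℤˣ) : ℝ :=
  ⨆ f, |∑ i, ((σ i : ℤ) : ℝ) * a f i|

section SignedSup

variable {ι κ : Type*} [Fintype κ]

lemma abs_unit_cast (ε : ℤˣ) : |((ε : ℤ) : ℝ)| = 1 := by
  rcases Int.units_eq_one_or ε with rfl | rfl <;> simp

lemma bddAbove_signedSum {a : ι → κ → ℝ} (ha : ∀ f i, |a f i| ≤ 1) (σ : κ → ℤˣ) :
    BddAbove (range fun f => |∑ i, ((σ i : ℤ) : ℝ) * a f i|) := by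
  refine ⟨∑ _i : κ, 1, ?_⟩
  rintro _ ⟨f, rfl⟩
  refine (Finset.abs_sum_le_sum_abs _ _).trans (Finset.sum_le_sum fun i _ => ?_)
  rw [abs_mul, abs_unit_cast, one_mul]
  exact ha f i

lemma signedSup_nonneg (a : ι → κ → ℝ) (σ : κ → ℤˣ) : 0 ≤ signedSup a σ :=
  Real.iSup_nonneg fun _ => abs_nonneg _

lemma le_signedSup {a : ι → κ → ℝ} (ha : ∀ f i, |a f i| ≤ 1) (σ : κ → ℤˣ) (f : ι) :
    |∑ i, ((σ i : ℤ) : ℝ) * a f i| ≤ signedSup a σ :=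
  le_ciSup (bddAbove_signedSum ha σ) f

/-- Flipping one sign moves each signed sum by at most `2`, hence also the supremum of their
absolute values. -/
lemma signedSup_le_update [DecidableEq κ] {a : ι → κ → ℝ} (ha : ∀ f i, |a f i| ≤ 1)
    (σ : κ → ℤˣ) (i : κ) : signedSup a σ ≤ signedSup a (Function.update σ i (-σ i)) + 2 := by
  refine Real.iSup_le (fun f => ?_) (by linarith [signedSup_nonneg a (Function.update σ i (-σ i))])
  have h1 : ∑ j, ((σ j : ℤ) : ℝ) * a f j
      = ∑ j, ((Function.update σ i (-σ i) j : ℤ) : ℝ) * a f j + 2 * (((σ i : ℤ) : ℝ) * a f i) := by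
    rw [← Finset.add_sum_erase _ _ (Finset.mem_univ i),
      ← Finset.add_sum_erase Finset.univ (fun j => ((Function.update σ i (-σ i) j : ℤ) : ℝ) * a f j)
        (Finset.mem_univ i)]
    rw [Finset.sum_congr rfl fun j hj => by
      rw [← Function.update_of_ne (Finset.ne_of_mem_erase hj) (-σ i) σ]]
    simp
    ring
  rw [h1]
  refine (abs_add_le _ _).trans (add_le_add (le_signedSup ha _ f) ?_)
  rw [abs_mul, abs_mul, abs_unit_cast, one_mul, abs_two]
  linarith [ha f i]

/-- Exponential moments of the supremum of a Rademacher process. -/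
lemma sum_exp_signedSup_le [DecidableEq κ] {a : ι → κ → ℝ} (ha : ∀ f i, |a f i| ≤ 1) (l : ℝ) :
    ∑ σ, Real.exp (l * signedSup a σ) ≤ 2 ^ Fintype.card κ
      * Real.exp (l * ((∑ σ, signedSup a σ) / 2 ^ Fintype.card κ) + Fintype.card κ * l ^ 2 / 2) := by
  refine sum_exp_le_of_bounded_diff _ l fun σ i => ?_
  rw [abs_le]
  have h1 := signedSup_le_update ha σ i
  have h2 := signedSup_le_update ha (Function.update σ i (-σ i)) i
  rw [Function.update_idem, Function.update_self, neg_neg, Function.update_eq_self] at h2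
  constructor <;> linarith

/-- Contraction: multipliers in `[-1, 1]` do not increase the Rademacher average. -/
lemma sum_signedSup_mul_le [DecidableEq κ] {a : ι → κ → ℝ} (ha : ∀ f i, |a f i| ≤ 1)
    {c : κ → ℝ} (hc : ∀ i, |c i| ≤ 1) :
    ∑ σ, signedSup (fun f i => c i * a f i) σ ≤ ∑ σ, signedSup a σ := by
  have bdd : ∀ (c : κ → ℝ) (σ : κ → ℤˣ),
      BddAbove (range fun f => |∑ i, ((σ i : ℤ) : ℝ) * (c i * a f i)|) := by
    intro c σ
    refine ⟨∑ i : κ, |c i|, ?_⟩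
    rintro _ ⟨f, rfl⟩
    refine (Finset.abs_sum_le_sum_abs _ _).trans (Finset.sum_le_sum fun i _ => ?_)
    rw [abs_mul, abs_unit_cast, one_mul, abs_mul]
    exact mul_le_of_le_one_right (abs_nonneg _) (ha f i)
  -- The sum of suprema is convex in the multipliers, so on the cube it is dominated by its value at
  -- some vertex, where all multipliers are `1` or `-1`.
  have conv : ConvexOn ℝ univ fun c : κ → ℝ => ∑ σ, signedSup (fun f i => c i * a f i) σ := by
    refine ⟨convex_univ, fun x _ y _ p q hp hq _ => ?_⟩
    simp only [smul_eq_mul, Finset.mul_sum]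
    rw [← Finset.sum_add_distrib]
    refine Finset.sum_le_sum fun σ _ => Real.iSup_le (fun f => ?_) (by
      have := signedSup_nonneg (fun f i => x i * a f i) σ
      have := signedSup_nonneg (fun f i => y i * a f i) σ
      positivity)
    have h1 : ∑ i, ((σ i : ℤ) : ℝ) * ((p • x + q • y) i * a f i)
        = p * ∑ i, ((σ i : ℤ) : ℝ) * (x i * a f i) + q * ∑ i, ((σ i : ℤ) : ℝ) * (y i * a f i) := by
      rw [Finset.mul_sum, Finset.mul_sum, ← Finset.sum_add_distrib]
      refine Finset.sum_congr rfl fun i _ => ?_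
      simp only [Pi.add_apply, Pi.smul_apply, smul_eq_mul]
      ring
    rw [h1]
    refine (abs_add_le _ _).trans ?_
    rw [abs_mul, abs_mul, abs_of_nonneg hp, abs_of_nonneg hq]
    gcongr
    · exact le_ciSup (bdd x σ) f
    · exact le_ciSup (bdd y σ) f
  have hmem : c ∈ convexHull ℝ (univ.pi fun _ : κ => ({-1, 1} : Set ℝ)) := by
    rw [convexHull_pi]
    intro i _
    rw [convexHull_pair, segment_eq_Icc (by norm_num)]
    exact abs_le.1 (hc i)
  obtain ⟨y, hy, hcy⟩ := conv.exists_ge_of_mem_convexHull (subset_univ _) hmem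
  refine hcy.trans (le_of_eq ?_)
  have hε : ∀ i, ∃ ε : ℤˣ, y i = ((ε : ℤ) : ℝ) := by
    intro i
    rcases hy i (mem_univ i) with h | h
    · exact ⟨-1, by simpa using h⟩
    · exact ⟨1, by simpa using h⟩
  choose ε hε using hε
  -- At a vertex the multipliers are signs, and multiplication by them only permutes the sign
  -- vectors.
  rw [← Equiv.sum_comp (Equiv.mulRight ε) (signedSup a)]
  refine Finset.sum_congr rfl fun σ _ => ?_
  simp only [signedSup, hε, Equiv.coe_mulRight, Pi.mul_apply]
  refine iSup_congr fun f => ?_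
  congr 1
  refine Finset.sum_congr rfl fun i _ => ?_
  rcases Int.units_eq_one_or (ε i) with h | h <;> simp [h]

end SignedSup

/-! ### Uniform deviations -/

section Deviation

variable {ι κ Ω : Type*}

/-- The sample that takes coordinate `i` from the first sample if `σ i = 1` and from the second
sample otherwise. -/
def interleave (σ : κ → ℤˣ) (p : (κ → Ω) × (κ → Ω)) : κ → Ω :=
  fun i => if σ i = 1 then p.1 i else p.2 i

/-- The samples for `σ` and `-σ` are complementary: at each coordinate one holds `x i` and the other
`y i`, with the sign deciding which. Each is itself an independent sample from the same law, so the
symmetrized sum splits into two signed sums over genuine samples. -/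
lemma sum_sub_eq_interleave [Fintype κ] (σ : κ → ℤˣ) (g : Ω → ℝ) (x y : κ → Ω) :
    ∑ i, (g (x i) - g (y i)) = ∑ i, ((σ i : ℤ) : ℝ) * g (interleave σ (x, y) i)
      - ∑ i, ((σ i : ℤ) : ℝ) * g (interleave (-σ) (x, y) i) := by
  rw [← Finset.sum_sub_distrib]
  refine Finset.sum_congr rfl fun i _ => ?_
  rcases Int.units_eq_one_or (σ i) with h | h
  · simp [interleave, h, show (-1 : ℤˣ) ≠ 1 by decide]
  · simp [interleave, h, show (-1 : ℤˣ) ≠ 1 by decide]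
    ring

variable [Fintype κ] [MeasurableSpace Ω]

lemma measurePreserving_interleave (μ : Measure Ω) [IsProbabilityMeasure μ] (σ : κ → ℤˣ) :
    MeasurePreserving (interleave σ)
      ((Measure.pi fun _ : κ => μ).prod (Measure.pi fun _ : κ => μ)) (Measure.pi fun _ => μ) := by
  have h := measurePreserving_pi (fun _ : κ => μ.prod μ) (fun _ => μ)
    (f := fun i p => if σ i = 1 then p.1 else p.2) (fun i => by
      by_cases hi : σ i = 1
      · simpa [hi] using measurePreserving_fst (μ := μ) (ν := μ)
      · simpa [hi] using measurePreserving_snd (μ := μ) (ν := μ))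
  exact h.comp ((measurePreserving_arrowProdEquivProdArrow Ω Ω κ (fun _ => μ) (fun _ => μ)).symm)

/-- Jensen's inequality for a ghost sample. -/
lemma exp_abs_sum_sub_integral_le (μ : Measure Ω) [IsProbabilityMeasure μ] {g : Ω → ℝ}
    (hg : Measurable g) (hg1 : ∀ o, |g o| ≤ 1) {l : ℝ} (hl : 0 ≤ l) (x : κ → Ω) :
    ENNReal.ofReal (Real.exp (l * |∑ i, (g (x i) - ∫ o, g o ∂μ)|))
      ≤ ∫⁻ y, ENNReal.ofReal (Real.exp (l * |∑ i, (g (x i) - g (y i))|))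
        ∂(Measure.pi fun _ : κ => μ) := by
  set W : (κ → Ω) → ℝ := fun y => ∑ i, (g (x i) - g (y i)) with hW
  have hWm : Measurable W := by
    refine Finset.measurable_sum _ fun i _ => ?_
    exact measurable_const.sub (hg.comp (measurable_pi_apply i))
  have hWb : ∀ y, |W y| ≤ ∑ _i : κ, 2 := fun y => by
    refine (Finset.abs_sum_le_sum_abs _ _).trans (Finset.sum_le_sum fun i _ => ?_)
    have h1 := abs_le.1 (hg1 (x i))
    have h2 := abs_le.1 (hg1 (y i))
    rw [abs_le]
    constructor <;> linarith [h1.1, h1.2, h2.1, h2.2]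
  have hgi : ∀ i : κ, Integrable (fun y : κ → Ω => g (y i)) (Measure.pi fun _ => μ) := fun i =>
    Integrable.of_bound (hg.comp (measurable_pi_apply i)).aestronglyMeasurable 1
      (ae_of_all _ fun y => hg1 (y i))
  have hWint : ∫ y, W y ∂(Measure.pi fun _ : κ => μ) = ∑ i, (g (x i) - ∫ o, g o ∂μ) := by
    have h := integral_finsetSum (Finset.univ : Finset κ) (μ := Measure.pi fun _ : κ => μ)
      fun i _ => (integrable_const (g (x i))).sub (hgi i)
    refine h.trans ?_
    refine Finset.sum_congr rfl fun i _ => ?_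
    rw [integral_sub' (integrable_const _) (hgi i), integral_const, probReal_univ, one_smul]
    congr 1
    exact integral_comp_eval (μ := fun _ : κ => μ) hg.aestronglyMeasurable
  have hWi : Integrable W (Measure.pi fun _ : κ => μ) :=
    Integrable.of_bound hWm.aestronglyMeasurable _ (ae_of_all _ hWb)
  have hconv : ConvexOn ℝ univ fun w : ℝ => Real.exp (l * |w|) := by
    refine ⟨convex_univ, fun x _ y _ p q hp hq hpq => ?_⟩
    refine le_trans (Real.exp_le_exp.2 ?_)
      (convexOn_exp.2 (mem_univ (l * |x|)) (mem_univ (l * |y|)) hp hq hpq)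
    simp only [smul_eq_mul]
    have := abs_add_le (p * x) (q * y)
    rw [abs_mul, abs_mul, abs_of_nonneg hp, abs_of_nonneg hq] at this
    nlinarith
  have hEm : Measurable fun y => Real.exp (l * |W y|) :=
    Real.measurable_exp.comp (measurable_const.mul hWm.abs)
  have hEi : Integrable (fun y => Real.exp (l * |W y|)) (Measure.pi fun _ : κ => μ) := by
    refine Integrable.of_bound hEm.aestronglyMeasurable (Real.exp (l * ∑ _i : κ, 2))
      (ae_of_all _ fun y => ?_)
    rw [Real.norm_eq_abs, Real.abs_exp]
    exact Real.exp_le_exp.2 (mul_le_mul_of_nonneg_left (hWb y) hl)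
  rw [← hWint, ← ofReal_integral_eq_lintegral_ofReal hEi (ae_of_all _ fun _ => (Real.exp_pos _).le)]
  refine ENNReal.ofReal_le_ofReal ?_
  exact hconv.map_integral_le (by fun_prop) isClosed_univ (by simp) hWi hEi

/-- Exponential tail bound for the uniform deviation of sample sums from their expectations, over
a class with Rademacher averages at most `R`. -/
lemma measure_deviation_le [DecidableEq κ] (μ : Measure Ω) [IsProbabilityMeasure μ]
    {g : ι → Ω → ℝ} (hg : ∀ f, Measurable (g f)) (hg1 : ∀ f o, |g f o| ≤ 1)
    (hmeas : ∀ σ : κ → ℤˣ, AEMeasurable (fun x : κ → Ω => signedSup (fun f i => g f (x i)) σ)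
      (Measure.pi fun _ => μ))
    {R : ℝ} (hR : ∀ x : κ → Ω,
      (∑ σ, signedSup (fun f i => g f (x i)) σ) / 2 ^ Fintype.card κ ≤ R)
    {l : ℝ} (hl : 0 ≤ l) (T : ℝ) :
    (Measure.pi fun _ : κ => μ) {x | ∃ f, T ≤ |∑ i, (g f (x i) - ∫ o, g f o ∂μ)|}
      ≤ ENNReal.ofReal (Real.exp (-(l * T) + 2 * l * R + 2 * l ^ 2 * Fintype.card κ)) := by
  set P := Measure.pi fun _ : κ => μ with hP
  set Ψ : (κ → ℤˣ) → (κ → Ω) → ENNReal :=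
    fun σ x => ENNReal.ofReal (Real.exp (2 * l * signedSup (fun f i => g f (x i)) σ)) with hΨ
  have hΨm : ∀ σ, AEMeasurable (Ψ σ) P := fun σ =>
    (Real.measurable_exp.comp_aemeasurable ((hmeas σ).const_mul (2 * l))).ennreal_ofReal
  -- This dominates the exponential of the symmetrized sum, since `exp (l (a + b))` is at most the
  -- mean of `exp (2 l a)` and `exp (2 l b)`. Interleaving preserves the law, so its integral is
  -- that of `Ψ σ` over one sample.
  set H : (κ → ℤˣ) → (κ → Ω) × (κ → Ω) → ENNReal :=
    fun σ p => 2⁻¹ * (Ψ σ (interleave σ p) + Ψ σ (interleave (-σ) p)) with hH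
  have hHm1 : ∀ σ τ, AEMeasurable (fun p => Ψ σ (interleave τ p)) (P.prod P) := fun σ τ =>
    (hΨm σ).comp_quasiMeasurePreserving (measurePreserving_interleave μ τ).quasiMeasurePreserving
  have hHm : ∀ σ, AEMeasurable (H σ) (P.prod P) := fun σ =>
    ((hHm1 σ σ).add (hHm1 σ (-σ))).const_mul _
  have hHint : ∀ σ, ∫⁻ x, ∫⁻ y, H σ (x, y) ∂P ∂P = ∫⁻ x, Ψ σ x ∂P := by
    intro σ
    have h1 : ∀ τ, ∫⁻ p, Ψ σ (interleave τ p) ∂(P.prod P) = ∫⁻ x, Ψ σ x ∂P := fun τ => by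
      have hτ : MeasurePreserving (interleave τ) (P.prod P) P := measurePreserving_interleave μ τ
      conv_rhs => rw [← hτ.map_eq, lintegral_map' (by rw [hτ.map_eq]; exact hΨm σ) hτ.measurable.aemeasurable]
    rw [← lintegral_prod _ (hHm σ)]
    refine (lintegral_const_mul'' _ ((hHm1 σ σ).add (hHm1 σ (-σ)))).trans ?_
    simp only [Pi.add_apply]
    rw [lintegral_add_left' (hHm1 σ σ), h1, h1, ← two_mul, ← mul_assoc,
      ENNReal.inv_mul_cancel two_ne_zero ENNReal.ofNat_ne_top, one_mul]
  have hdom : ∀ x f σ, ENNReal.ofReal (Real.exp (l * |∑ i, (g f (x i) - ∫ o, g f o ∂μ)|))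
      ≤ ∫⁻ y, H σ (x, y) ∂P := by
    intro x f σ
    refine (exp_abs_sum_sub_integral_le μ (hg f) (hg1 f) hl x).trans (lintegral_mono fun y => ?_)
    set a := signedSup (fun f i => g f (interleave σ (x, y) i)) σ
    set b := signedSup (fun f i => g f (interleave (-σ) (x, y) i)) σ
    have h1 : |∑ i, (g f (x i) - g f (y i))| ≤ a + b := by
      rw [sum_sub_eq_interleave σ]
      exact (abs_sub _ _).trans (add_le_add (le_signedSup (a := fun f i => g f (interleave σ (x, y) i))
        (fun f i => hg1 f _) σ f)
        (le_signedSup (a := fun f i => g f (interleave (-σ) (x, y) i)) (fun f i => hg1 f _) σ f))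
    have h2 : Real.exp (l * |∑ i, (g f (x i) - g f (y i))|)
        ≤ 2⁻¹ * (Real.exp (2 * l * a) + Real.exp (2 * l * b)) := by
      have h3 : Real.exp (l * |∑ i, (g f (x i) - g f (y i))|) ≤ Real.exp (l * a) * Real.exp (l * b) := by
        rw [← Real.exp_add, ← mul_add]
        exact Real.exp_le_exp.2 (mul_le_mul_of_nonneg_left h1 hl)
      have h4 : ∀ c : ℝ, Real.exp (2 * l * c) = Real.exp (l * c) ^ 2 := fun c => by
        rw [← Real.exp_nat_mul]; congr 1; push_cast; ring
      rw [h4, h4]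
      nlinarith [sq_nonneg (Real.exp (l * a) - Real.exp (l * b))]
    refine (ENNReal.ofReal_le_ofReal h2).trans (le_of_eq ?_)
    rw [ENNReal.ofReal_mul (by norm_num), ENNReal.ofReal_add (Real.exp_pos _).le (Real.exp_pos _).le,
      ENNReal.ofReal_inv_of_pos two_pos, ENNReal.ofReal_ofNat]
  set J : (κ → Ω) → ENNReal := fun x => ∑ σ, ∫⁻ y, H σ (x, y) ∂P with hJ
  have hJm1 : ∀ σ, AEMeasurable (fun x => ∫⁻ y, H σ (x, y) ∂P) P := fun σ =>
    (hHm σ).lintegral_prod_right'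
  have hJm : AEMeasurable J P := Finset.aemeasurable_fun_sum _ fun σ _ => hJm1 σ
  have hJint : ∫⁻ x, J x ∂P ≤ ENNReal.ofReal (2 ^ Fintype.card κ
      * Real.exp (2 * l * R + 2 * l ^ 2 * Fintype.card κ)) := by
    rw [hJ, lintegral_finsetSum' _ fun σ _ => hJm1 σ]
    simp_rw [hHint]
    rw [← lintegral_finsetSum' _ fun σ _ => hΨm σ]
    calc ∫⁻ x, ∑ σ, Ψ σ x ∂P ≤ ∫⁻ _x, ENNReal.ofReal (2 ^ Fintype.card κ
          * Real.exp (2 * l * R + 2 * l ^ 2 * Fintype.card κ)) ∂P := by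
          refine lintegral_mono fun x => ?_
          rw [hΨ, ← ENNReal.ofReal_sum_of_nonneg fun _ _ => (Real.exp_pos _).le]
          refine ENNReal.ofReal_le_ofReal ((sum_exp_signedSup_le (fun f i => hg1 f _) _).trans ?_)
          gcongr ?_ * Real.exp ?_
          have := mul_le_mul_of_nonneg_left (hR x) (by positivity : 0 ≤ 2 * l)
          nlinarith
      _ = _ := by rw [lintegral_const, measure_univ, mul_one]
  set c := ENNReal.ofReal (2 ^ Fintype.card κ * Real.exp (l * T)) with hc
  have hc0 : c ≠ 0 := by
    rw [hc, Ne, ENNReal.ofReal_eq_zero, not_le]; positivity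
  -- The deviation event need not be measurable. It lies in a superlevel set of the almost
  -- everywhere measurable `J`, to which Markov's inequality applies: the bound of `hdom` holds for
  -- each of the `2 ^ card κ` sign vectors.
  have hsub : {x | ∃ f, T ≤ |∑ i, (g f (x i) - ∫ o, g f o ∂μ)|} ⊆ {x | c ≤ J x} := by
    rintro x ⟨f, hf⟩
    have h1 : ∀ σ ∈ (Finset.univ : Finset (κ → ℤˣ)),
        ENNReal.ofReal (Real.exp (l * T)) ≤ ∫⁻ y, H σ (x, y) ∂P := fun σ _ =>
      (ENNReal.ofReal_le_ofReal (Real.exp_le_exp.2 (mul_le_mul_of_nonneg_left hf hl))).trans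
        (hdom x f σ)
    have h2 := Finset.sum_le_sum h1
    rw [Finset.sum_const, Finset.card_univ, Fintype.card_fun, Fintype.card_units_int, nsmul_eq_mul] at h2
    refine le_trans (le_of_eq ?_) h2
    rw [hc, ENNReal.ofReal_mul (by positivity)]
    congr 1
    rw [ENNReal.ofReal_pow zero_le_two]
    push_cast
    simp
  have hmk := (mul_meas_ge_le_lintegral₀ hJm c).trans hJint
  refine (measure_mono hsub).trans ?_
  rw [ENNReal.mul_le_iff_le_inv hc0 ENNReal.ofReal_ne_top, hc,
    ← ENNReal.ofReal_inv_of_pos (by positivity), ← ENNReal.ofReal_mul (by positivity)] at hmk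
  refine hmk.trans (le_of_eq ?_)
  congr 1
  rw [mul_inv, ← Real.exp_neg, mul_mul_mul_comm, inv_mul_cancel₀ (by positivity), one_mul,
    ← Real.exp_add]
  congr 1
  ring

end Deviation

/-! ### Uniform deviations of threshold classes -/

lemma threshold_nonneg {𝒳 : Type*} (f : 𝒳 → unitInterval) (x : 𝒳) (z : ℝ) : 0 ≤ threshold f x z := by
  unfold threshold; split_ifs <;> norm_num

lemma threshold_le_one {𝒳 : Type*} (f : 𝒳 → unitInterval) (x : 𝒳) (z : ℝ) : threshold f x z ≤ 1 := by
  unfold threshold; split_ifs <;> norm_num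

lemma abs_threshold_le_one {𝒳 : Type*} (f : 𝒳 → unitInterval) (x : 𝒳) (z : ℝ) :
    |threshold f x z| ≤ 1 := by
  rw [abs_of_nonneg (threshold_nonneg f x z)]
  exact threshold_le_one f x z

lemma measurable_threshold {𝒳 : Type*} [MeasurableSpace 𝒳] {f : 𝒳 → unitInterval}
    (hf : Measurable f) (z : ℝ) : Measurable fun x => threshold f x z :=
  Measurable.ite (measurableSet_le measurable_const (measurable_subtype_coe.comp hf))
    measurable_const measurable_const

/-- The Rademacher complexity bounds the Rademacher averages at all sample points. -/
lemma sum_signedSup_le_rademacherComplexity {U ι : Type*} (h : ι → U → ℝ) (F : Set ι)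
    (hb : ∀ f u, |h f u| ≤ 1) {m : ℕ} (hm : 0 < m) (u : Fin m → U) :
    (∑ σ, signedSup (fun (f : F) i => h f (u i)) σ) / 2 ^ m
      ≤ m * rademacherComplexity ((fun f u => h f u) '' F) m := by
  have hm' : (0 : ℝ) < m := by exact_mod_cast hm
  have key : ∀ v : Fin m → U, (∑ σ : Fin m → ℤˣ, ⨆ g : ((fun f u => h f u) '' F : Set (U → ℝ)),
      |(∑ i, ((σ i : ℤ) : ℝ) * g.1 (v i)) / m|) / 2 ^ m
      = (∑ σ, signedSup (fun (f : F) i => h f (v i)) σ) / 2 ^ m / m := by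
    intro v
    rw [div_right_comm]
    congr 1
    rw [Finset.sum_div]
    refine Finset.sum_congr rfl fun σ _ => ?_
    rw [← (imageFactorization_surjective (f := fun f u => h f u) (s := F)).iSup_comp, signedSup,
      div_eq_inv_mul, Real.mul_iSup_of_nonneg (by positivity)]
    refine iSup_congr fun f => ?_
    rw [abs_div, abs_of_pos hm', div_eq_inv_mul]
    rfl
  -- Boundedness is essential: a real supremum over an unbounded set is `0` by convention and would
  -- bound nothing.
  have hbdd : BddAbove (range fun v : Fin m → U => (∑ σ : Fin m → ℤˣ,
      ⨆ g : ((fun f u => h f u) '' F : Set (U → ℝ)),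
        |(∑ i, ((σ i : ℤ) : ℝ) * g.1 (v i)) / m|) / 2 ^ m) := by
    refine ⟨(∑ _σ : Fin m → ℤˣ, (m : ℝ)) / 2 ^ m / m, ?_⟩
    rintro _ ⟨v, rfl⟩
    refine (key v).trans_le ?_
    gcongr with σ _
    refine Real.iSup_le (fun f => (Finset.abs_sum_le_sum_abs _ _).trans ?_) hm'.le
    calc ∑ i, |((σ i : ℤ) : ℝ) * h f (v i)| ≤ ∑ _i : Fin m, (1 : ℝ) := by
          refine Finset.sum_le_sum fun i _ => ?_
          rw [abs_mul, abs_unit_cast, one_mul]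
          exact hb _ _
      _ = m := by simp
  have h1 : _ ≤ rademacherComplexity ((fun f u => h f u) '' F) m := le_ciSup hbdd u
  rw [key, div_le_iff₀ hm', mul_comm] at h1
  exact h1

/-- Rademacher averages do not depend on the index type of the sample. -/
lemma sum_signedSup_comp_equiv {ι κ κ' : Type*} [Fintype κ] [Fintype κ'] [DecidableEq κ]
    [DecidableEq κ'] (e : κ' ≃ κ) (a : ι → κ → ℝ) :
    ∑ σ, signedSup a σ = ∑ σ, signedSup (fun f i => a f (e i)) σ := by
  rw [← Equiv.sum_comp (e.arrowCongr (Equiv.refl ℤˣ)) (signedSup a)]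
  refine Finset.sum_congr rfl fun σ _ => ?_
  simp only [signedSup]
  refine iSup_congr fun f => ?_
  rw [← e.sum_comp]
  simp

/-- The product of conditional laws is the conditional law of the product. -/
lemma pi_cond {κ Ω : Type*} [Fintype κ] [MeasurableSpace Ω] (μ : Measure Ω) [IsProbabilityMeasure μ]
    {E : Set Ω} (hE : MeasurableSet E) :
    Measure.pi (fun _ : κ => μ[|E])
      = ((μ E)⁻¹) ^ Fintype.card κ • (Measure.pi fun _ : κ => μ).restrict (univ.pi fun _ => E) := by
  refine Measure.pi_eq fun s hs => ?_
  rw [Measure.smul_apply, Measure.restrict_apply (MeasurableSet.univ_pi hs), ← pi_inter_distrib,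
    Measure.pi_pi, smul_eq_mul, ← Finset.card_univ, ← Finset.prod_const, ← Finset.prod_mul_distrib]
  refine Finset.prod_congr rfl fun i _ => ?_
  rw [cond_apply hE, inter_comm]

/-- A function of a parameter with finitely many values. -/
lemma aemeasurable_comp_of_finite_range {α β : Type*} [MeasurableSpace α] {μ : Measure α}
    [MeasurableSpace β] [MeasurableSingletonClass β] {v : α → β} (hv : Measurable v)
    (hfin : (range v).Finite) {Φ : β → α → ℝ} (hΦ : ∀ s, AEMeasurable (Φ s) μ) :
    AEMeasurable (fun x => Φ (v x) x) μ := by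
  have := hfin.to_subtype
  have hU : ⋃ s : range v, v ⁻¹' {s.1} = univ :=
    eq_univ_of_forall fun x => mem_iUnion.2 ⟨⟨v x, x, rfl⟩, rfl⟩
  rw [← Measure.restrict_univ (μ := μ), ← hU, aemeasurable_iUnion_iff]
  intro s
  refine ((hΦ s.1).restrict).congr ?_
  filter_upwards [ae_restrict_mem (hv (measurableSet_singleton s.1))] with x hx
  rw [show v x = s.1 from hx]

namespace Setting

variable {𝒳 : Type u} [MeasurableSpace 𝒳] (S : Setting 𝒳)

instance : IsProbabilityMeasure S.law := S.law_prob

variable {κ : Type*} [Fintype κ]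

/-- The weights take finitely many values. On each set where the weight vector is a constant `s`,
the assumption on the class applies with coefficients `σ i * s i`. -/
lemma aemeasurable_signedSup_threshold {z : ℝ}
    (hz : MeasurableClass ((fun f x => threshold f x z) '' S.predictors) (S.law.map Prod.fst))
    {w : S.Obs → ℝ} (hw : Measurable w) (hfin : (range w).Finite) (σ : κ → ℤˣ) :
    AEMeasurable (fun x : κ → S.Obs =>
        signedSup (fun (f : S.predictors) i => w (x i) * threshold f.1 (x i).1 z) σ)
      (Measure.pi fun _ => S.law) := by
  have hv : Measurable fun (x : κ → S.Obs) i => w (x i) :=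
    measurable_pi_lambda _ fun i => hw.comp (measurable_pi_apply i)
  have hvfin : (range fun (x : κ → S.Obs) i => w (x i)).Finite := by
    refine (Finite.pi' fun _ : κ => hfin).subset ?_
    rintro _ ⟨x, rfl⟩ i
    exact mem_range_self _
  refine aemeasurable_comp_of_finite_range
    (Φ := fun s x => signedSup (fun (f : S.predictors) i => s i * threshold f.1 (x i).1 z) σ)
    hv hvfin fun s => ?_
  have : IsProbabilityMeasure (S.law.map Prod.fst) :=
    Measure.isProbabilityMeasure_map measurable_fst.aemeasurable
  set e := (Fintype.equivFin κ).symm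
  have h := hz (Fintype.card κ) fun i => ((σ (e i) : ℤ) : ℝ) * s (e i)
  have h1 : MeasurePreserving (fun (x : κ → S.Obs) i => (x i).1) (Measure.pi fun _ => S.law)
      (Measure.pi fun _ => S.law.map Prod.fst) :=
    measurePreserving_pi (fun _ : κ => S.law) (fun _ => S.law.map Prod.fst)
      fun _ => ⟨measurable_fst, rfl⟩
  have h2 := (measurePreserving_piCongrLeft (fun _ : κ => S.law.map Prod.fst) e).symm
  refine (h.comp_quasiMeasurePreserving (h2.comp h1).quasiMeasurePreserving).congr
    (ae_of_all _ fun x => ?_)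
  simp only [Function.comp_apply, signedSup]
  rw [← (imageFactorization_surjective (f := fun (f : 𝒳 → unitInterval) x => threshold f x z)
    (s := S.predictors)).iSup_comp]
  refine iSup_congr fun f => ?_
  rw [← e.sum_comp]
  congr 1
  refine Finset.sum_congr rfl fun i _ => ?_
  rw [mul_assoc]
  rfl

/-- The uniform deviation over a sample of size `m`, at confidence level `δ`. -/
noncomputable def deviation (C φ δ : ℝ) (m : ℕ) : ℝ :=
  2 * (C * (m : ℝ) ^ (-φ)) + √(8 * Real.log (1 / δ) / m)

/-- The sampling law `ν` is separate from the law of the setting so that conditional laws are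
covered. Absolute continuity transfers the measurability assumption to it. -/
lemma measure_threshold_deviation_le [DecidableEq κ] {C φ : ℝ}
    (hR : ∀ m : ℕ, 1 ≤ m →
      rademacherComplexity (thresholdClass S.predictors) m ≤ C * (m : ℝ) ^ (-φ))
    {z : ℝ} (hz01 : z ∈ Icc (0 : ℝ) 1)
    (hz : MeasurableClass ((fun f x => threshold f x z) '' S.predictors) (S.law.map Prod.fst))
    {w : S.Obs → ℝ} (hw : Measurable w) (hfin : (range w).Finite) (hw1 : ∀ o, |w o| ≤ 1)
    (ν : Measure S.Obs) [IsProbabilityMeasure ν]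
    (hν : Measure.pi (fun _ : κ => ν) ≪ Measure.pi fun _ => S.law)
    (hκ : 0 < Fintype.card κ) {δ : ℝ} (hδ0 : 0 < δ) (hδ1 : δ ≤ 1) :
    (Measure.pi fun _ : κ => ν) {x | ∃ f : S.predictors, deviation C φ δ (Fintype.card κ) ≤
      |(∑ i, w (x i) * threshold f.1 (x i).1 z) / Fintype.card κ
        - ∫ o, w o * threshold f.1 o.1 z ∂ν|} ≤ ENNReal.ofReal δ := by
  set m := Fintype.card κ with hm
  have hm0 : (0 : ℝ) < m := by exact_mod_cast hκ
  have hb : ∀ (f : S.predictors) (o : S.Obs), |w o * threshold f.1 o.1 z| ≤ 1 := fun f o => by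
    rw [abs_mul]
    exact mul_le_one₀ (hw1 o) (abs_nonneg _) (abs_threshold_le_one _ _ _)
  have hRad : ∀ x : κ → S.Obs, (∑ σ, signedSup
      (fun (f : S.predictors) i => w (x i) * threshold f.1 (x i).1 z) σ) / 2 ^ Fintype.card κ
      ≤ m * (C * (m : ℝ) ^ (-φ)) := by
    intro x
    have h1 := sum_signedSup_mul_le
      (a := fun (f : S.predictors) i => threshold f.1 (x i).1 z) (c := fun i => w (x i))
      (fun f i => abs_threshold_le_one _ _ _) (fun i => hw1 _)
    rw [sum_signedSup_comp_equiv (Fintype.equivFin κ).symm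
      (fun (f : S.predictors) i => threshold f.1 (x i).1 z)] at h1
    have h2 := sum_signedSup_le_rademacherComplexity
      (fun (f : 𝒳 → unitInterval) (u : 𝒳 × unitInterval) => threshold f u.1 (u.2 : ℝ)) S.predictors
      (fun f u => abs_threshold_le_one _ _ _) hκ
      (fun i => ((x ((Fintype.equivFin κ).symm i)).1, ⟨z, hz01⟩))
    refine (div_le_div_of_nonneg_right h1 (by positivity)).trans (h2.trans ?_)
    exact mul_le_mul_of_nonneg_left (hR m hκ) hm0.le
  have hlog : 0 ≤ Real.log (1 / δ) := Real.log_nonneg (one_le_one_div hδ0 hδ1)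
  set u := √(8 * Real.log (1 / δ) / m) with hu
  have hu2 : u ^ 2 * m = 8 * Real.log (1 / δ) := by
    rw [hu, Real.sq_sqrt (by positivity), div_mul_cancel₀ _ hm0.ne']
  -- The Rademacher terms cancel, and `l = u / 4` minimizes the remaining exponent `-l m u + 2 l²
  -- m`, giving `-u² m / 8 = log δ`.
  have h := measure_deviation_le (κ := κ) ν
    (g := fun (f : S.predictors) (o : S.Obs) => w o * threshold f.1 o.1 z)
    (fun f => hw.mul ((measurable_threshold (S.predictors_measurable f.1 f.2) z).comp measurable_fst))
    hb (fun σ => (S.aemeasurable_signedSup_threshold hz hw hfin σ).mono_ac hν) hRad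
    (l := u / 4) (by positivity) (m * deviation C φ δ m)
  rw [← hm] at h
  have hexp : Real.exp (-(u / 4 * (m * deviation C φ δ m)) + 2 * (u / 4) * (m * (C * (m : ℝ) ^ (-φ)))
      + 2 * (u / 4) ^ 2 * m) = δ := by
    rw [deviation, ← hu]
    have : -(u / 4 * (m * (2 * (C * (m : ℝ) ^ (-φ)) + u))) + 2 * (u / 4) * (m * (C * (m : ℝ) ^ (-φ)))
      + 2 * (u / 4) ^ 2 * m = -(u ^ 2 * m) / 8 := by ring
    rw [this, hu2, one_div, Real.log_inv]
    rw [show -(8 * -Real.log δ) / 8 = Real.log δ by ring, Real.exp_log hδ0]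
  rw [hexp] at h
  refine (measure_mono ?_).trans h
  rintro x ⟨f, hf⟩
  refine ⟨f, ?_⟩
  rw [Finset.sum_sub_distrib, Finset.sum_const, Finset.card_univ, ← hm, nsmul_eq_mul]
  rw [← mul_div_cancel₀ (∑ i, w (x i) * threshold f.1 (x i).1 z) hm0.ne', ← mul_sub,
    abs_mul, abs_of_pos hm0]
  exact mul_le_mul_of_nonneg_left hf hm0.le

end Setting

/-! ### Single functions and random subsamples -/

/-- Hoeffding's inequality for the upper tail of a sample average. -/
lemma measure_average_ge_le {Ω : Type*} [MeasurableSpace Ω] (μ : Measure Ω) [IsProbabilityMeasure μ]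
    {g : Ω → ℝ} (hg : Measurable g) (hg01 : ∀ o, g o ∈ Icc (0 : ℝ) 1) {n : ℕ} (hn : 0 < n) {t : ℝ}
    (ht : 0 ≤ t) :
    (Measure.pi fun _ : Fin n => μ) {ω | ∫ o, g o ∂μ + t ≤ (∑ i, g (ω i)) / n}
      ≤ ENNReal.ofReal (Real.exp (-(2 * n * t ^ 2))) := by
  have hn' : (0 : ℝ) < n := by exact_mod_cast hn
  set P := Measure.pi fun _ : Fin n => μ with hP
  have hgi : ∀ i : Fin n, Measurable fun ω : Fin n → Ω => g (ω i) := fun i =>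
    hg.comp (measurable_pi_apply i)
  have hint : ∀ i : Fin n, ∫ ω, g (ω i) ∂P = ∫ o, g o ∂μ := fun i =>
    integral_comp_eval (μ := fun _ : Fin n => μ) hg.aestronglyMeasurable
  have hind : iIndepFun (fun (i : Fin n) (ω : Fin n → Ω) => g (ω i) - ∫ o, g o ∂μ) P :=
    iIndepFun_pi (μ := fun _ : Fin n => μ) (X := fun _ o => g o - ∫ o, g o ∂μ)
      fun _ => (hg.sub_const _).aemeasurable
  have hsub : ∀ i ∈ (Finset.univ : Finset (Fin n)),
      HasSubgaussianMGF (fun ω : Fin n → Ω => g (ω i) - ∫ o, g o ∂μ) ((‖(1 : ℝ) - 0‖₊ / 2) ^ 2) P := by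
    intro i _
    have := hasSubgaussianMGF_of_mem_Icc (μ := P) (X := fun ω => g (ω i)) (hgi i).aemeasurable
      (ae_of_all _ fun ω => hg01 (ω i))
    rwa [hint] at this
  have h := HasSubgaussianMGF.measure_sum_ge_le_of_iIndepFun hind hsub (ε := n * t) (by positivity)
  have hset : {ω : Fin n → Ω | ∫ o, g o ∂μ + t ≤ (∑ i, g (ω i)) / n}
      = {ω | n * t ≤ ∑ i, (g (ω i) - ∫ o, g o ∂μ)} := by
    ext ω
    simp only [mem_ofPred_eq]
    rw [le_div_iff₀ hn', Finset.sum_sub_distrib]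
    simp
    constructor <;> intro h <;> linarith
  rw [hset, ← ofReal_measureReal]
  refine ENNReal.ofReal_le_ofReal (h.trans (le_of_eq ?_))
  congr 1
  simp
  field_simp

/-- An event for the subsample in `E` that has conditional probability at most `δ` given the
index set of the subsample has probability at most `δ`. -/
lemma measure_subsample_le {Ω : Type*} [MeasurableSpace Ω] (μ : Measure Ω) [IsProbabilityMeasure μ]
    {E : Set Ω} (hE : MeasurableSet E) (hE0 : μ E ≠ 0) {n : ℕ}
    (B : (I : Finset (Fin n)) → Set ({i // i ∈ I} → Ω)) {δ : ENNReal}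
    (hB : ∀ I, (Measure.pi fun _ => μ[|E]) (B I) ≤ δ) :
    (Measure.pi fun _ : Fin n => μ)
      {ω | ∃ I : Finset (Fin n), (∀ i, i ∈ I ↔ ω i ∈ E) ∧ (fun i : {i // i ∈ I} => ω i) ∈ B I} ≤ δ := by
  classical
  set P := Measure.pi fun _ : Fin n => μ with hP
  set A : Finset (Fin n) → Set (Fin n → Ω) := fun I => {ω | ∀ i, i ∈ I ↔ ω i ∈ E} with hA
  have key : ∀ I, P {ω | ω ∈ A I ∧ (fun i : {i // i ∈ I} => ω i) ∈ B I} ≤ δ * P (A I) := by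
    intro I
    set P₁ := Measure.pi fun _ : {i // i ∈ I} => μ with hP₁
    set P₂ := Measure.pi fun _ : {i // i ∉ I} => μ with hP₂
    have hmp : MeasurePreserving (MeasurableEquiv.piEquivPiSubtypeProd (fun _ : Fin n => Ω)
        fun i => i ∈ I) P (P₁.prod P₂) := by
      convert measurePreserving_piEquivPiSubtypeProd (fun _ : Fin n => μ) (fun i => i ∈ I)
    set D₁ : Set ({i // i ∈ I} → Ω) := univ.pi fun _ => E with hD₁
    set D₂ : Set ({i // i ∉ I} → Ω) := univ.pi fun _ => Eᶜ with hD₂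
    -- Coordinates inside and outside `I` are independent. The set `V` is arbitrary: the rectangle
    -- formula and preimages under a measurable equivalence require no measurability.
    have hprod : ∀ V : Set ({i // i ∈ I} → Ω), P {ω | ω ∈ A I ∧ (fun i : {i // i ∈ I} => ω i) ∈ V}
        = P₁ (V ∩ D₁) * P₂ D₂ := by
      intro V
      rw [← Measure.prod_prod, ← hmp.measure_preimage_equiv]
      congr 1
      ext ω
      simp only [hA, hD₁, hD₂, mem_ofPred_eq, mem_preimage, mem_prod, mem_inter_iff, mem_pi, mem_univ,
        true_imp_iff, mem_compl_iff, MeasurableEquiv.piEquivPiSubtypeProd_apply, Subtype.forall]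
      constructor
      · rintro ⟨h1, h2⟩
        exact ⟨⟨h2, fun i hi => (h1 i).1 hi⟩, fun i hi h => hi ((h1 i).2 h)⟩
      · rintro ⟨⟨h1, h2⟩, h3⟩
        exact ⟨fun i => ⟨h2 i, fun h => by_contra fun hi => h3 i hi h⟩, h1⟩
    have hAI : P (A I) = P₁ D₁ * P₂ D₂ := by
      have := hprod univ
      simpa using this
    rw [hprod, hAI, ← mul_assoc]
    gcongr
    have hc := hB I
    rw [pi_cond μ hE, Measure.smul_apply, Measure.restrict_apply' (MeasurableSet.univ_pi fun _ => hE),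
      smul_eq_mul, ← hD₁, ← hP₁] at hc
    have hD₁' : P₁ D₁ = μ E ^ Fintype.card {i // i ∈ I} := by
      rw [hP₁, hD₁, Measure.pi_pi, Finset.prod_const, Finset.card_univ]
    have h0 : μ E ^ Fintype.card {i // i ∈ I} ≠ 0 := pow_ne_zero _ hE0
    have ht : μ E ^ Fintype.card {i // i ∈ I} ≠ ⊤ := ENNReal.pow_ne_top (measure_ne_top _ _)
    rw [hD₁', mul_comm δ]
    rw [← ENNReal.inv_pow] at hc
    calc P₁ (B I ∩ D₁) = μ E ^ Fintype.card {i // i ∈ I} *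
          ((μ E ^ Fintype.card {i // i ∈ I})⁻¹ * P₁ (B I ∩ D₁)) := by
          rw [← mul_assoc, ENNReal.mul_inv_cancel h0 ht, one_mul]
      _ ≤ _ := by gcongr
  have hAmeas : ∀ I, MeasurableSet (A I) := by
    intro I
    have : A I = ⋂ i, {ω | i ∈ I ↔ ω i ∈ E} := by ext ω; simp [hA]
    rw [this]
    refine MeasurableSet.iInter fun i => ?_
    by_cases hi : i ∈ I
    · simp only [hi, true_iff]
      exact (measurable_pi_apply i : Measurable fun ω : Fin n → Ω => ω i) hE
    · simp only [hi, false_iff]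
      exact (measurable_pi_apply i : Measurable fun ω : Fin n → Ω => ω i) hE.compl
  have hdisj : ((Finset.univ : Finset (Finset (Fin n))) : Set (Finset (Fin n))).PairwiseDisjoint A := by
    intro I _ J _ hIJ
    refine Set.disjoint_left.2 fun ω h1 h2 => hIJ ?_
    ext i
    rw [h1 i, h2 i]
  calc P {ω | ∃ I : Finset (Fin n), (∀ i, i ∈ I ↔ ω i ∈ E) ∧ (fun i : {i // i ∈ I} => ω i) ∈ B I}
      ≤ P (⋃ I ∈ (Finset.univ : Finset (Finset (Fin n))),
          {ω | ω ∈ A I ∧ (fun i : {i // i ∈ I} => ω i) ∈ B I}) := by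
        refine measure_mono ?_
        rintro ω ⟨I, hI⟩
        simp only [mem_iUnion]
        exact ⟨I, Finset.mem_univ _, hI⟩
    _ ≤ ∑ I, δ * P (A I) := (measure_biUnion_finset_le _ _).trans (Finset.sum_le_sum fun I _ => key I)
    _ = δ * P (⋃ I ∈ (Finset.univ : Finset (Finset (Fin n))), A I) := by
        rw [measure_biUnion_finset hdisj fun I _ => hAmeas I, Finset.mul_sum]
    _ ≤ δ * 1 := by gcongr; exact prob_le_one
    _ = δ := mul_one δ

namespace Setting

variable {𝒳 : Type u} [MeasurableSpace 𝒳] (S : Setting 𝒳)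

lemma measurableSet_event (a : Fin 2) : MeasurableSet {o : S.Obs | o.2 ∈ S.event a} :=
  measurable_snd (S.event_measurable a)

/-- Uniform deviation of the group averages of threshold classifiers. -/
lemma measure_group_deviation_le {C φ : ℝ}
    (hR : ∀ m : ℕ, 1 ≤ m →
      rademacherComplexity (thresholdClass S.predictors) m ≤ C * (m : ℝ) ^ (-φ))
    {z : ℝ} (hz01 : z ∈ Icc (0 : ℝ) 1)
    (hz : MeasurableClass ((fun f x => threshold f x z) '' S.predictors) (S.law.map Prod.fst))
    {a : Fin 2} (ha : S.law {o | o.2 ∈ S.event a} ≠ 0) (n : ℕ)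
    {δ : ℝ} (hδ0 : 0 < δ) (hδ1 : δ ≤ 1) :
    S.sampleLaw n {ω | 0 < (S.group ω a).card ∧ ∃ f : S.predictors,
      deviation C φ δ (S.group ω a).card ≤
        |(∑ i ∈ S.group ω a, threshold f.1 (ω i).1 z) / (S.group ω a).card
          - ∫ o, threshold f.1 o.1 z ∂(S.law[|{o | o.2 ∈ S.event a}])|} ≤ ENNReal.ofReal δ := by
  classical
  set E : Set S.Obs := {o | o.2 ∈ S.event a} with hE
  have : IsProbabilityMeasure (S.law[|E]) := cond_isProbabilityMeasure ha
  refine (measure_mono ?_).trans (measure_subsample_le S.law (S.measurableSet_event a) ha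
    (fun I => {x | 0 < I.card ∧ ∃ f : S.predictors, deviation C φ δ I.card ≤
      |(∑ i, threshold f.1 (x i).1 z) / I.card
        - ∫ o, threshold f.1 o.1 z ∂(S.law[|E])|}) (δ := ENNReal.ofReal δ) fun I => ?_)
  · rintro ω ⟨h0, f, hf⟩
    refine ⟨S.group ω a, fun i => by simp [group], h0, f, ?_⟩
    rwa [Finset.sum_coe_sort (S.group ω a) fun i => threshold f.1 (ω i).1 z]
  · by_cases hI : 0 < I.card
    -- The product of conditional laws is a multiple of a restriction of the original product law.
    · have hac : (Measure.pi fun _ : {i // i ∈ I} => S.law[|E]) ≪ Measure.pi fun _ => S.law := by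
        rw [pi_cond S.law (S.measurableSet_event a)]
        exact (Measure.absolutelyContinuous_of_le Measure.restrict_le_self).smul_left _
      have h := S.measure_threshold_deviation_le (κ := {i // i ∈ I}) hR hz01 hz
        (w := fun _ => 1) measurable_const ((finite_singleton (1 : ℝ)).subset (by
          rintro _ ⟨_, rfl⟩; rfl)) (by simp) (S.law[|E]) hac (by simpa using hI) hδ0 hδ1
      simp only [one_mul, Fintype.card_coe] at h
      simpa [hI] using h
    · simp [hI]

end Setting

/-! ### Discretization -/

/-- The classifier accepts `j / N` exactly when `j ≤ ⌊N f(x)⌋`, so the weighted sum is an initial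
segment, ready to telescope. -/
lemma sum_mul_threshold {𝒳 : Type*} (f : 𝒳 → unitInterval) (x : 𝒳) {N : ℕ} (hN : 0 < N) (a : ℕ → ℝ) :
    ∑ j ∈ Finset.Icc 1 N, a j * threshold f x ((j : ℝ) / N)
      = ∑ j ∈ Finset.range ⌊N * (f x : ℝ)⌋₊, a (j + 1) := by
  have hN' : (0 : ℝ) < N := by exact_mod_cast hN
  set k := ⌊N * (f x : ℝ)⌋₊ with hk
  have hkN : k ≤ N := by
    have : N * (f x : ℝ) ≤ N := mul_le_of_le_one_right hN'.le (f x).2.2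
    exact_mod_cast (Nat.floor_le (mul_nonneg hN'.le (f x).2.1)).trans this
  have hthr : ∀ j : ℕ, threshold f x ((j : ℝ) / N) = if j ≤ k then 1 else 0 := by
    intro j
    have : (j : ℝ) / N ≤ (f x : ℝ) ↔ j ≤ k := by
      rw [div_le_iff₀ hN', mul_comm, hk, Nat.le_floor_iff (mul_nonneg hN'.le (f x).2.1)]
    simp only [threshold, this]
  simp only [hthr, mul_ite, mul_one, mul_zero]
  rw [← Finset.sum_filter]
  refine Finset.sum_nbij' (fun j => j - 1) (fun j => j + 1) ?_ ?_ ?_ ?_ ?_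
  · intro j hj
    simp only [Finset.mem_filter, Finset.mem_Icc] at hj
    rw [Finset.mem_range]
    omega
  · intro j hj
    rw [Finset.mem_range] at hj
    simp only [Finset.mem_filter, Finset.mem_Icc]
    omega
  · intro j hj
    simp only [Finset.mem_filter, Finset.mem_Icc] at hj
    omega
  · intro j _
    rfl
  · intro j hj
    simp only [Finset.mem_filter, Finset.mem_Icc] at hj
    rw [Nat.sub_add_cancel hj.1.1]

lemma abs_sum_threshold_div_sub_le {𝒳 : Type*} (f : 𝒳 → unitInterval) (x : 𝒳) {N : ℕ} (hN : 0 < N) :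
    |(∑ j ∈ Finset.Icc 1 N, threshold f x ((j : ℝ) / N)) / N - f x| ≤ 1 / N := by
  have hN' : (0 : ℝ) < N := by exact_mod_cast hN
  have h := sum_mul_threshold f x hN fun _ => 1
  simp only [one_mul, Finset.sum_const, Finset.card_range, nsmul_eq_mul, mul_one] at h
  have h1 := Nat.floor_le (mul_nonneg hN'.le (f x).2.1)
  have h2 := Nat.lt_floor_add_one (N * (f x : ℝ))
  rw [h, div_sub' hN'.ne', abs_div, abs_of_pos hN']
  gcongr
  rw [abs_le]
  constructor <;> linarith

/-- A finite set has finitely many subsets, and each is the filtered set on a measurable event;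
hence `G` can be arbitrary. -/
lemma measurable_filter_comp {α β γ : Type*} [MeasurableSpace α] [MeasurableSpace γ]
    (s : Finset β) (p : α → β → Prop) [∀ a, DecidablePred (p a)]
    (hp : ∀ b, MeasurableSet {a | p a b}) (G : Finset β → γ) :
    Measurable fun a => G (s.filter (p a)) := by
  classical
  intro t _
  have h : (fun a => G (s.filter (p a))) ⁻¹' t
      = ⋃ A ∈ (s.powerset.filter fun A => G A ∈ t), ⋂ b ∈ s, {a | b ∈ A ↔ p a b} := by
    ext a
    simp only [mem_preimage, mem_iUnion, Finset.mem_filter, Finset.mem_powerset, mem_iInter,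
      mem_ofPred_eq, exists_prop]
    constructor
    · intro ha
      exact ⟨s.filter (p a), ⟨Finset.filter_subset _ _, ha⟩, fun b hb => by simp [hb]⟩
    · rintro ⟨A, ⟨hA, hG⟩, hAb⟩
      convert hG using 2
      ext b
      rw [Finset.mem_filter]
      exact ⟨fun h => (hAb b h.1).2 h.2, fun h => ⟨hA h, (hAb b (hA h)).1 h⟩⟩
  rw [h]
  refine Finset.measurableSet_biUnion _ fun A _ => Finset.measurableSet_biInter _ fun b _ => ?_
  by_cases hb : b ∈ A
  · simpa only [hb, true_iff] using hp b
  · simp only [hb, false_iff]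
    exact (hp b).compl

namespace Setting

variable {𝒳 : Type u} [MeasurableSpace 𝒳] (S : Setting 𝒳)

lemma lower_mem {N : ℕ} {cov : Finset S.outcomes} (hcov : S.IsCover N cov) (y : S.outcomes) :
    S.lower N cov y ∈ cov ∧ |(y : ℝ) - S.lower N cov y| ≤ 1 / (2 * (N : ℝ)) := by
  classical
  obtain ⟨y', hy', h⟩ := hcov y
  have hne : (Finset.filter (fun y' : S.outcomes => |(y : ℝ) - y'| ≤ 1 / (2 * (N : ℝ))) cov).Nonempty :=
    ⟨y', Finset.mem_filter.2 ⟨hy', h⟩⟩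
  have hmem := Finset.min'_mem _ hne
  have : S.lower N cov y = Finset.min' _ hne := by
    unfold lower
    convert dif_pos hne
  rw [this]
  exact Finset.mem_filter.1 hmem

lemma measurable_comp_lower {γ : Type*} [MeasurableSpace γ] {N : ℕ} {cov : Finset S.outcomes}
    (hcov : S.IsCover N cov) (g : S.outcomes → γ) : Measurable fun y => g (S.lower N cov y) := by
  classical
  by_cases hne : Nonempty S.outcomes
  · obtain ⟨y₀⟩ := hne
    have h := measurable_filter_comp cov
      (fun y y' : S.outcomes => |(y : ℝ) - y'| ≤ 1 / (2 * (N : ℝ))) (fun y' =>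
        measurableSet_le (measurable_subtype_coe.sub_const _).abs measurable_const)
      -- `lower` falls back on `y` itself; a fixed `y₀` makes the value depend on the filtered set
      -- alone. The cover property ensures that neither fallback is used.
      fun A => g (if h : A.Nonempty then A.min' h else y₀)
    convert h using 2 with y
    obtain ⟨y', hy', hyy'⟩ := hcov y
    have hne : (Finset.filter (fun y' : S.outcomes => |(y : ℝ) - y'| ≤ 1 / (2 * (N : ℝ))) cov).Nonempty :=
      ⟨y', Finset.mem_filter.2 ⟨hy', hyy'⟩⟩
    rw [dif_pos hne]
    congr 1
    unfold lower
    convert dif_pos hne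
  · have : IsEmpty S.outcomes := not_nonempty_iff.1 hne
    exact measurable_of_empty _

lemma finite_range_comp_lower {γ : Type*} {N : ℕ} {cov : Finset S.outcomes}
    (hcov : S.IsCover N cov) (g : S.outcomes → γ) :
    (range fun o : S.Obs => g (S.lower N cov o.2.2)).Finite := by
  refine (cov.finite_toSet.image g).subset ?_
  rintro _ ⟨o, rfl⟩
  exact mem_image_of_mem g (S.lower_mem hcov o.2.2).1

lemma abs_ellAt_sub_le (y y' : S.outcomes) (u v : ℝ) :
    |S.ellAt y u - S.ellAt y' v| ≤ |(y : ℝ) - y'| + |u - v| := by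
  refine (S.ell_lipschitz _ _ _ _).trans (add_le_add_right ?_ _)
  have := (LipschitzWith.projIcc (zero_le_one' ℝ)).dist_le_mul u v
  simpa [Subtype.dist_eq, Real.dist_eq] using this

lemma ellAt_coe (y : S.outcomes) (u : unitInterval) : S.ellAt y u = S.ell y u := by
  rw [ellAt, projIcc_val]

lemma ellAt_nonneg (y : S.outcomes) (u : ℝ) : 0 ≤ S.ellAt y u := (S.ell _ _).2.1

lemma ellAt_le_one (y : S.outcomes) (u : ℝ) : S.ellAt y u ≤ 1 := (S.ell _ _).2.2

lemma abs_c_le_one {N : ℕ} (hN : 0 < N) (y : S.outcomes) (z : ℝ) : |S.c N y z| ≤ 1 := by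
  have hN' : (0 : ℝ) < N := by exact_mod_cast hN
  rw [c, abs_mul, abs_of_pos hN']
  have h := S.abs_ellAt_sub_le y y (z + 1 / (2 * (N : ℝ))) (z - 1 / (2 * (N : ℝ)))
  rw [sub_self, abs_zero, zero_add, show z + 1 / (2 * (N : ℝ)) - (z - 1 / (2 * (N : ℝ))) = 1 / N by
    field_simp; ring, abs_of_pos (one_div_pos.2 hN')] at h
  calc _ ≤ N * (1 / (N : ℝ)) := mul_le_mul_of_nonneg_left h hN'.le
    _ = 1 := by field_simp

/-- The expected cost of `h_f` on one observation, over the random threshold. -/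
noncomputable def obsCost (N : ℕ) (cov : Finset S.outcomes) (f : S.predictors) (o : S.Obs) : ℝ :=
  (∑ j ∈ Finset.Icc 1 N,
    S.c N (S.lower N cov o.2.2) ((j : ℝ) / N) * threshold f.1 o.1 ((j : ℝ) / N)) / N

/-- With `α = 1/N`, the upper argument `j α + α/2` of one increment is the lower argument of the
next, so the costs telescope. -/
lemma obsCost_add_ellAt {N : ℕ} (hN : 0 < N) (cov : Finset S.outcomes) (f : S.predictors)
    (o : S.Obs) : S.obsCost N cov f o + S.ellAt (S.lower N cov o.2.2) (1 / (2 * (N : ℝ)))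
      = S.ellAt (S.lower N cov o.2.2) (⌊N * (f.1 o.1 : ℝ)⌋₊ / N + 1 / (2 * (N : ℝ))) := by
  have hN' : (0 : ℝ) < N := by exact_mod_cast hN
  set y := S.lower N cov o.2.2
  have h1 : S.obsCost N cov f o = ∑ j ∈ Finset.range ⌊N * (f.1 o.1 : ℝ)⌋₊,
      (S.ellAt y (((j + 1 : ℕ) : ℝ) / N + 1 / (2 * (N : ℝ)))
        - S.ellAt y ((j : ℝ) / N + 1 / (2 * (N : ℝ)))) := by
    rw [obsCost, sum_mul_threshold f.1 o.1 hN fun j => S.c N y ((j : ℝ) / N), Finset.sum_div]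
    refine Finset.sum_congr rfl fun j _ => ?_
    rw [c, mul_div_cancel_left₀ _ hN'.ne']
    congr 3
    push_cast
    field_simp
    ring
  rw [h1, Finset.sum_range_sub fun j : ℕ => S.ellAt y ((j : ℝ) / N + 1 / (2 * (N : ℝ)))]
  simp

/-- Half of `1/N` comes from rounding the outcome to the cover, half from moving the prediction to
the midpoint of its grid cell. -/
lemma abs_obsCost_add_ellAt_sub_ell_le {N : ℕ} (hN : 0 < N) {cov : Finset S.outcomes}
    (hcov : S.IsCover N cov) (f : S.predictors) (o : S.Obs) :
    |S.obsCost N cov f o + S.ellAt (S.lower N cov o.2.2) (1 / (2 * (N : ℝ)))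
      - S.ell o.2.2 (f.1 o.1)| ≤ 1 / N := by
  have hN' : (0 : ℝ) < N := by exact_mod_cast hN
  rw [S.obsCost_add_ellAt hN, ← S.ellAt_coe]
  refine (S.abs_ellAt_sub_le _ _ _ _).trans ?_
  have h1 := (S.lower_mem hcov o.2.2).2
  rw [abs_sub_comm] at h1
  have h2 : |(⌊N * (f.1 o.1 : ℝ)⌋₊ : ℝ) / N + 1 / (2 * (N : ℝ)) - f.1 o.1| ≤ 1 / (2 * (N : ℝ)) := by
    have h3 := Nat.floor_le (mul_nonneg hN'.le (f.1 o.1).2.1)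
    have h4 := (Nat.lt_floor_add_one (N * (f.1 o.1 : ℝ))).le
    rw [abs_le]
    constructor
    · rw [← div_le_div_iff_of_pos_right hN'] at h4
      have : (⌊N * (f.1 o.1 : ℝ)⌋₊ + 1 : ℝ) / N
        = (⌊N * (f.1 o.1 : ℝ)⌋₊ : ℝ) / N + 1 / (2 * (N : ℝ)) + 1 / (2 * (N : ℝ)) := by field_simp; ring
      rw [this, mul_div_cancel_left₀ _ hN'.ne'] at h4
      linarith
    · rw [← div_le_div_iff_of_pos_right hN', mul_div_cancel_left₀ _ hN'.ne'] at h3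
      linarith
  calc _ ≤ 1 / (2 * (N : ℝ)) + 1 / (2 * (N : ℝ)) := add_le_add h1 h2
    _ = 1 / N := by field_simp; ring

lemma abs_obsCost_le_one {N : ℕ} (hN : 0 < N) (cov : Finset S.outcomes) (f : S.predictors)
    (o : S.Obs) : |S.obsCost N cov f o| ≤ 1 := by
  have h := S.obsCost_add_ellAt hN cov f o
  have h1 := S.ellAt_nonneg (S.lower N cov o.2.2) (1 / (2 * (N : ℝ)))
  have h2 := S.ellAt_le_one (S.lower N cov o.2.2) (1 / (2 * (N : ℝ)))
  have h3 := S.ellAt_nonneg (S.lower N cov o.2.2) (⌊N * (f.1 o.1 : ℝ)⌋₊ / N + 1 / (2 * (N : ℝ)))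
  have h4 := S.ellAt_le_one (S.lower N cov o.2.2) (⌊N * (f.1 o.1 : ℝ)⌋₊ / N + 1 / (2 * (N : ℝ)))
  rw [abs_le]
  constructor <;> linarith

lemma empCost_eq {n : ℕ} (N : ℕ) (cov : Finset S.outcomes) (ω : Fin n → S.Obs) (f : S.predictors) :
    S.empCost N cov ω f = (∑ i, S.obsCost N cov f (ω i)) / n := rfl

lemma measurable_obsCost {N : ℕ} {cov : Finset S.outcomes} (hcov : S.IsCover N cov)
    (f : S.predictors) : Measurable (S.obsCost N cov f) := by
  refine Measurable.div_const (Finset.measurable_sum _ fun j _ => ?_) _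
  exact ((S.measurable_comp_lower hcov fun y => S.c N y ((j : ℝ) / N)).comp
    (measurable_snd.comp measurable_snd)).mul
      ((measurable_threshold (S.predictors_measurable f.1 f.2) _).comp measurable_fst)

/-- Measurability of the loss is not assumed; it follows from joint Lipschitz continuity. -/
lemma measurable_ell (f : S.predictors) :
    Measurable fun o : S.Obs => (S.ell o.2.2 (f.1 o.1) : ℝ) := by
  have hc : LipschitzWith 2 fun p : S.outcomes × unitInterval => (S.ell p.1 p.2 : ℝ) := by
    refine LipschitzWith.of_dist_le_mul fun p q => ?_
    have h := S.ell_lipschitz p.1 p.2 q.1 q.2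
    have h1 : |(p.1 : ℝ) - q.1| ≤ dist p q := le_max_left _ _
    have h2 : |(p.2 : ℝ) - q.2| ≤ dist p q := le_max_right _ _
    rw [Real.dist_eq]
    push_cast
    linarith
  exact hc.continuous.measurable.comp ((measurable_snd.comp measurable_snd).prodMk
    ((S.predictors_measurable f.1 f.2).comp measurable_fst))

end Setting

/-! ### Means and integrals -/

section MeanIntegral

variable {ι Ω : Type*} [MeasurableSpace Ω] (Q : PMF ι) {g : ι → Ω → ℝ}

lemma mean_finsetSum {κ : Type*} (s : Finset κ) {h : κ → ι → ℝ} {M : ℝ} (hb : ∀ k i, |h k i| ≤ M) :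
    mean Q (fun i => ∑ k ∈ s, h k i) = ∑ k ∈ s, mean Q (h k) := by
  simp only [mean, Finset.mul_sum]
  exact Summable.tsum_finsetSum fun k _ => summable_mean Q (hb k)

lemma mean_div_const (h : ι → ℝ) (c : ℝ) : mean Q (fun i => h i / c) = mean Q h / c := by
  simp only [div_eq_inv_mul, mean_const_mul]

/-- The class may be uncountable, but the support of `Q` is countable, which reduces measurability
and Fubini arguments to countable sums. -/
lemma mean_eq_tsum_support (h : ι → ℝ) : mean Q h = ∑' i : Q.support, (Q i).toReal * h i := by
  refine (tsum_subtype_eq_of_support_subset fun i hi => ?_).symm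
  rw [PMF.mem_support_iff]
  intro h0
  simp [h0] at hi

lemma measurable_mean (hg : ∀ i, Measurable (g i)) {M : ℝ} (hb : ∀ i o, |g i o| ≤ M) :
    Measurable fun o => mean Q fun i => g i o := by
  have hc : Countable Q.support := Q.support_countable.to_subtype
  have hs : ∀ o, HasSum (fun i : Q.support => (Q i).toReal * g i o) (mean Q fun i => g i o) := by
    intro o
    rw [mean_eq_tsum_support]
    exact ((summable_mean Q fun i => hb i o).subtype _).hasSum
  refine measurable_of_tendsto_metrizable' Filter.atTop
    (f := fun (s : Finset Q.support) o => ∑ i ∈ s, (Q i).toReal * g i o)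
    (fun s => Finset.measurable_sum _ fun i _ => (hg i).const_mul _) ?_
  exact tendsto_pi_nhds.2 fun o => hs o

lemma integral_mean (μ : Measure Ω) [IsProbabilityMeasure μ] (hg : ∀ i, Measurable (g i)) {M : ℝ}
    (hb : ∀ i o, |g i o| ≤ M) :
    ∫ o, mean Q (fun i => g i o) ∂μ = mean Q fun i => ∫ o, g i o ∂μ := by
  have hc : Countable Q.support := Q.support_countable.to_subtype
  have hM : ∀ i : ι, ∫ o, ‖g i o‖ ∂μ ≤ M := by
    intro i
    have := integral_mono_of_nonneg (μ := μ) (ae_of_all _ fun o => norm_nonneg (g i o))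
      (integrable_const M) (ae_of_all _ fun o => hb i o)
    simpa using this
  have hi : ∀ i : Q.support, Integrable (fun o => (Q i).toReal * g i o) μ := fun i =>
    (Integrable.of_bound (hg i).aestronglyMeasurable M (ae_of_all _ (hb i))).const_mul _
  simp only [mean_eq_tsum_support]
  rw [← integral_tsum_of_summable_integral_norm hi]
  · exact tsum_congr fun i => integral_const_mul _ _
  · refine Summable.of_nonneg_of_le (fun i => integral_nonneg fun o => norm_nonneg _) (fun i => ?_)
      (((summable_pmf_toReal Q).mul_right M).subtype Q.support)
    simp only [norm_mul, Real.norm_eq_abs, ENNReal.abs_toReal, Function.comp_apply]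
    rw [integral_const_mul]
    exact mul_le_mul_of_nonneg_left (hM i) ENNReal.toReal_nonneg

end MeanIntegral

lemma abs_integral_le {Ω : Type*} [MeasurableSpace Ω] (μ : Measure Ω) [IsProbabilityMeasure μ]
    {g : Ω → ℝ} {M : ℝ} (hg : ∀ o, |g o| ≤ M) : |∫ o, g o ∂μ| ≤ M := by
  have := norm_integral_le_of_norm_le_const (μ := μ) (f := g) (ae_of_all _ hg)
  simpa using this

lemma abs_sum_div_card_le {κ : Type*} (s : Finset κ) {a : κ → ℝ} {M : ℝ} (hM : 0 ≤ M)
    (ha : ∀ i ∈ s, |a i| ≤ M) : |(∑ i ∈ s, a i) / s.card| ≤ M := by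
  rw [abs_div, Nat.abs_cast]
  refine div_le_of_le_mul₀ (Nat.cast_nonneg _) hM ?_
  calc |∑ i ∈ s, a i| ≤ ∑ i ∈ s, |a i| := Finset.abs_sum_le_sum_abs _ _
    _ ≤ ∑ _i ∈ s, M := Finset.sum_le_sum ha
    _ = M * s.card := by simp [mul_comm]

lemma abs_sum_Icc_div_le {N : ℕ} {a : ℕ → ℝ} {M : ℝ} (hM : 0 ≤ M)
    (ha : ∀ j ∈ Finset.Icc 1 N, |a j| ≤ M) : |(∑ j ∈ Finset.Icc 1 N, a j) / N| ≤ M := by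
  simpa using abs_sum_div_card_le _ hM ha

lemma abs_sum_fin_div_le {n : ℕ} {a : Fin n → ℝ} {M : ℝ} (hM : 0 ≤ M) (ha : ∀ i, |a i| ≤ M) :
    |(∑ i, a i) / n| ≤ M := by
  simpa using abs_sum_div_card_le Finset.univ hM fun i _ => ha i

/-! ### Sample and population quantities -/

namespace Setting

variable {𝒳 : Type u} [MeasurableSpace 𝒳] (S : Setting 𝒳)

lemma abs_ell_le_one (y : S.outcomes) (u : unitInterval) : |(S.ell y u : ℝ)| ≤ 1 := by
  rw [abs_of_nonneg (S.ell y u).2.1]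
  exact (S.ell y u).2.2

lemma abs_empCost_le_one {n N : ℕ} (hN : 0 < N) (cov : Finset S.outcomes) (ω : Fin n → S.Obs)
    (f : S.predictors) : |S.empCost N cov ω f| ≤ 1 :=
  abs_sum_fin_div_le zero_le_one fun i => S.abs_obsCost_le_one hN cov f (ω i)

lemma abs_empC0_le_one {n : ℕ} (N : ℕ) (cov : Finset S.outcomes) (ω : Fin n → S.Obs) :
    |S.empC0 N cov ω| ≤ 1 :=
  abs_sum_fin_div_le zero_le_one fun i => by
    rw [abs_of_nonneg (S.ellAt_nonneg _ _)]
    exact S.ellAt_le_one _ _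

lemma abs_gridAverage_le_one {𝒳 : Type*} (f : 𝒳 → unitInterval) (x : 𝒳) (N : ℕ) :
    |(∑ j ∈ Finset.Icc 1 N, threshold f x ((j : ℝ) / N)) / N| ≤ 1 :=
  abs_sum_Icc_div_le zero_le_one fun _ _ => abs_threshold_le_one _ _ _

lemma gridAverage_nonneg {𝒳 : Type*} (f : 𝒳 → unitInterval) (x : 𝒳) (N : ℕ) :
    0 ≤ (∑ j ∈ Finset.Icc 1 N, threshold f x ((j : ℝ) / N)) / N :=
  div_nonneg (Finset.sum_nonneg fun _ _ => threshold_nonneg _ _ _) (Nat.cast_nonneg _)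

/-- The average of `E_Z h_f(X, Z)` over the observations in the event `a`. -/
noncomputable def groupAverage {n : ℕ} (N : ℕ) (ω : Fin n → S.Obs) (a : Fin 2)
    (f : S.predictors) : ℝ :=
  (∑ i ∈ S.group ω a,
    (∑ j ∈ Finset.Icc 1 N, threshold f.1 (ω i).1 ((j : ℝ) / N)) / N) / (S.group ω a).card

lemma groupAverage_mem {n : ℕ} (N : ℕ) (ω : Fin n → S.Obs) (a : Fin 2) (f : S.predictors) :
    S.groupAverage N ω a f ∈ Icc (0 : ℝ) 1 := by
  refine ⟨div_nonneg (Finset.sum_nonneg fun _ _ => gridAverage_nonneg _ _ _) (Nat.cast_nonneg _), ?_⟩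
  exact (le_abs_self _).trans (abs_sum_div_card_le _ zero_le_one fun i _ => abs_gridAverage_le_one _ _ _)

lemma empDisparity_eq {n : ℕ} (N : ℕ) (ω : Fin n → S.Obs) (f : S.predictors) :
    S.empDisparity N ω f = S.β 0 * S.groupAverage N ω 0 f + S.β 1 * S.groupAverage N ω 1 f :=
  Fin.sum_univ_two _

/-- The conditional expectation `E[f(X) | 𝓔_a]`. -/
noncomputable def groupMean (a : Fin 2) (f : S.predictors) : ℝ :=
  ∫ o, (f.1 o.1 : ℝ) ∂(S.law[|{o | o.2 ∈ S.event a}])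

lemma disparity_eq (f : S.predictors) :
    S.disparity f = S.β 0 * S.groupMean 0 f + S.β 1 * S.groupMean 1 f :=
  Fin.sum_univ_two _

lemma groupMean_mem (a : Fin 2) (f : S.predictors) : S.groupMean a f ∈ Icc (0 : ℝ) 1 := by
  refine ⟨integral_nonneg fun o => (f.1 o.1).2.1, ?_⟩
  by_cases ha : S.law {o | o.2 ∈ S.event a} = 0
  · rw [groupMean, cond_eq_zero_of_meas_eq_zero ha, integral_zero_measure]
    exact zero_le_one
  · have : IsProbabilityMeasure (S.law[|{o | o.2 ∈ S.event a}]) := cond_isProbabilityMeasure ha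
    have h := integral_mono_of_nonneg (μ := S.law[|{o | o.2 ∈ S.event a}])
      (ae_of_all _ fun o => (f.1 o.1).2.1) (integrable_const (1 : ℝ))
      (ae_of_all _ fun o => (f.1 o.1).2.2)
    rw [integral_const, probReal_univ, one_smul] at h
    exact h

lemma abs_disparity_le (f : S.predictors) : |S.disparity f| ≤ |S.β 0| + |S.β 1| := by
  rw [disparity_eq]
  refine (abs_add_le _ _).trans ?_
  have h := fun a => S.groupMean_mem a f
  rw [abs_mul, abs_mul, abs_of_nonneg (h 0).1, abs_of_nonneg (h 1).1]
  exact add_le_add (mul_le_of_le_one_right (abs_nonneg _) (h 0).2)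
    (mul_le_of_le_one_right (abs_nonneg _) (h 1).2)

lemma abs_empDisparity_le {n : ℕ} (N : ℕ) (ω : Fin n → S.Obs) (f : S.predictors) :
    |S.empDisparity N ω f| ≤ |S.β 0| + |S.β 1| := by
  rw [empDisparity_eq]
  refine (abs_add_le _ _).trans ?_
  have h := fun a => S.groupAverage_mem N ω a f
  rw [abs_mul, abs_mul, abs_of_nonneg (h 0).1, abs_of_nonneg (h 1).1]
  exact add_le_add (mul_le_of_le_one_right (abs_nonneg _) (h 0).2)
    (mul_le_of_le_one_right (abs_nonneg _) (h 1).2)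

lemma abs_mul_sub_le {β x y : ℝ} (hx : x ∈ Icc (0 : ℝ) 1) (hy : y ∈ Icc (0 : ℝ) 1) :
    |β * x - β * y| ≤ |β| := by
  rw [← mul_sub, abs_mul]
  refine mul_le_of_le_one_right (abs_nonneg _) ?_
  rw [abs_le]
  constructor <;> linarith [hx.1, hx.2, hy.1, hy.2]

/-- The range of the empirical disparity has length at most `|β₀| + |β₁|`. -/
lemma mean_empDisparity_sub_le {n : ℕ} (N : ℕ) (ω : Fin n → S.Obs) (Q Q' : PMF S.predictors) :
    mean Q (S.empDisparity N ω) - mean Q' (S.empDisparity N ω) ≤ |S.β 0| + |S.β 1| := by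
  have hb := S.abs_empDisparity_le N ω
  have h : ∀ f f', S.empDisparity N ω f ≤ S.empDisparity N ω f' + (|S.β 0| + |S.β 1|) := by
    intro f f'
    rw [empDisparity_eq, empDisparity_eq]
    have h0 := le_of_abs_le
      (abs_mul_sub_le (β := S.β 0) (S.groupAverage_mem N ω 0 f) (S.groupAverage_mem N ω 0 f'))
    have h1 := le_of_abs_le
      (abs_mul_sub_le (β := S.β 1) (S.groupAverage_mem N ω 1 f) (S.groupAverage_mem N ω 1 f'))
    linarith
  have h1 : ∀ f', mean Q (S.empDisparity N ω) - (|S.β 0| + |S.β 1|) ≤ S.empDisparity N ω f' := by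
    intro f'
    have := mean_le_mean_add Q (h := fun _ => S.empDisparity N ω f') hb (fun _ => le_rfl) (h · f')
    rw [mean_const] at this
    linarith
  have h2 := mean_mono Q' (fun _ => le_rfl) hb h1
  rw [mean_const] at h2
  linarith

/-- Deviations at every threshold of the grid bound the deviation of the cost. -/
lemma abs_empCost_sub_integral_le {n N : ℕ} {cov : Finset S.outcomes}
    (hcov : S.IsCover N cov) {ω : Fin n → S.Obs} {t : ℝ} (ht : 0 ≤ t) (f : S.predictors)
    (h : ∀ j ∈ Finset.Icc 1 N,
      |(∑ i, S.c N (S.lower N cov (ω i).2.2) ((j : ℝ) / N) * threshold f.1 (ω i).1 ((j : ℝ) / N)) / n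
        - ∫ o, S.c N (S.lower N cov o.2.2) ((j : ℝ) / N) * threshold f.1 o.1 ((j : ℝ) / N) ∂S.law| ≤ t) :
    |S.empCost N cov ω f - ∫ o, S.obsCost N cov f o ∂S.law| ≤ t := by
  have hint : ∀ j ∈ Finset.Icc 1 N, Integrable (fun o : S.Obs =>
      S.c N (S.lower N cov o.2.2) ((j : ℝ) / N) * threshold f.1 o.1 ((j : ℝ) / N)) S.law := by
    intro j hj
    have hN : 0 < N := by rw [Finset.mem_Icc] at hj; omega
    refine Integrable.of_bound (Measurable.aestronglyMeasurable ?_) 1 (ae_of_all _ fun o => ?_)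
    · exact ((S.measurable_comp_lower hcov fun y => S.c N y ((j : ℝ) / N)).comp
        (measurable_snd.comp measurable_snd)).mul
          ((measurable_threshold (S.predictors_measurable f.1 f.2) _).comp measurable_fst)
    · rw [Real.norm_eq_abs, abs_mul]
      exact mul_le_one₀ (S.abs_c_le_one hN _ _) (abs_nonneg _) (abs_threshold_le_one _ _ _)
  have h1 : S.empCost N cov ω f = (∑ j ∈ Finset.Icc 1 N, (∑ i,
      S.c N (S.lower N cov (ω i).2.2) ((j : ℝ) / N) * threshold f.1 (ω i).1 ((j : ℝ) / N)) / n) / N := by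
    rw [empCost, ← Finset.sum_div, ← Finset.sum_div, Finset.sum_comm, div_right_comm]
  have h2 : ∫ o, S.obsCost N cov f o ∂S.law = (∑ j ∈ Finset.Icc 1 N, ∫ o,
      S.c N (S.lower N cov o.2.2) ((j : ℝ) / N) * threshold f.1 o.1 ((j : ℝ) / N) ∂S.law) / N := by
    simp only [obsCost]
    rw [integral_div, integral_finsetSum _ hint]
  rw [h1, h2, ← sub_div, ← Finset.sum_sub_distrib]
  exact abs_sum_Icc_div_le ht h

/-- Deviations at every threshold of the grid bound the deviation of the group averages. -/
lemma abs_groupAverage_sub_groupMean_le {n N : ℕ} (hN : 0 < N) {ω : Fin n → S.Obs} {a : Fin 2}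
    (ha : S.law {o | o.2 ∈ S.event a} ≠ 0) {t : ℝ} (ht : 0 ≤ t) (f : S.predictors)
    (h : ∀ j ∈ Finset.Icc 1 N,
      |(∑ i ∈ S.group ω a, threshold f.1 (ω i).1 ((j : ℝ) / N)) / (S.group ω a).card
        - ∫ o, threshold f.1 o.1 ((j : ℝ) / N) ∂(S.law[|{o | o.2 ∈ S.event a}])| ≤ t) :
    |S.groupAverage N ω a f - S.groupMean a f| ≤ t + 1 / N := by
  set ν := S.law[|{o | o.2 ∈ S.event a}] with hν
  have : IsProbabilityMeasure ν := cond_isProbabilityMeasure ha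
  have hfm : Measurable fun o : S.Obs => (f.1 o.1 : ℝ) :=
    measurable_subtype_coe.comp ((S.predictors_measurable f.1 f.2).comp measurable_fst)
  have hint : ∀ j ∈ Finset.Icc 1 N, Integrable (fun o : S.Obs =>
      threshold f.1 o.1 ((j : ℝ) / N)) ν := fun j _ =>
    Integrable.of_bound ((measurable_threshold (S.predictors_measurable f.1 f.2) _).comp
      measurable_fst).aestronglyMeasurable 1 (ae_of_all _ fun o => abs_threshold_le_one _ _ _)
  have hfi : Integrable (fun o : S.Obs => (f.1 o.1 : ℝ)) ν :=
    Integrable.of_bound hfm.aestronglyMeasurable 1 (ae_of_all _ fun o => by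
      rw [Real.norm_eq_abs, abs_of_nonneg (f.1 o.1).2.1]; exact (f.1 o.1).2.2)
  have h1 : S.groupAverage N ω a f = (∑ j ∈ Finset.Icc 1 N,
      (∑ i ∈ S.group ω a, threshold f.1 (ω i).1 ((j : ℝ) / N)) / (S.group ω a).card) / N := by
    rw [groupAverage, ← Finset.sum_div, ← Finset.sum_div, Finset.sum_comm, div_right_comm]
  have hgi : Integrable (fun o : S.Obs =>
      (∑ j ∈ Finset.Icc 1 N, threshold f.1 o.1 ((j : ℝ) / N)) / N) ν :=
    (integrable_finsetSum _ hint).div_const _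
  have h2 : ∫ o, (∑ j ∈ Finset.Icc 1 N, threshold f.1 o.1 ((j : ℝ) / N)) / N ∂ν
      = (∑ j ∈ Finset.Icc 1 N, ∫ o, threshold f.1 o.1 ((j : ℝ) / N) ∂ν) / N := by
    rw [integral_div, integral_finsetSum _ hint]
  have h3 : |S.groupAverage N ω a f
      - ∫ o, (∑ j ∈ Finset.Icc 1 N, threshold f.1 o.1 ((j : ℝ) / N)) / N ∂ν| ≤ t := by
    rw [h1, h2, ← sub_div, ← Finset.sum_sub_distrib]
    exact abs_sum_Icc_div_le ht h
  have h4 : |∫ o, (∑ j ∈ Finset.Icc 1 N, threshold f.1 o.1 ((j : ℝ) / N)) / N ∂ν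
      - S.groupMean a f| ≤ 1 / N := by
    rw [groupMean, ← hν, ← integral_sub hgi hfi]
    exact abs_integral_le ν fun o : S.Obs => abs_sum_threshold_div_sub_le f.1 o.1 hN
  exact (abs_sub_le _ _ _).trans (add_le_add h3 h4)

/-- The loss is bounded by its discretized empirical version. -/
lemma loss_le {n N : ℕ} (hN : 0 < N) {cov : Finset S.outcomes} (hcov : S.IsCover N cov)
    {ω : Fin n → S.Obs} {t t' : ℝ} (f : S.predictors)
    (h : |S.empCost N cov ω f - ∫ o, S.obsCost N cov f o ∂S.law| ≤ t)
    (h' : ∫ o, S.ellAt (S.lower N cov o.2.2) (1 / (2 * (N : ℝ))) ∂S.law ≤ S.empC0 N cov ω + t') :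
    S.loss f ≤ S.empCost N cov ω f + S.empC0 N cov ω + t + t' + 1 / N := by
  have hm0 : Measurable fun o : S.Obs => S.ellAt (S.lower N cov o.2.2) (1 / (2 * (N : ℝ))) :=
    (S.measurable_comp_lower hcov fun y => S.ellAt y (1 / (2 * (N : ℝ)))).comp
      (measurable_snd.comp measurable_snd)
  have hi0 : Integrable (fun o : S.Obs => S.ellAt (S.lower N cov o.2.2) (1 / (2 * (N : ℝ)))) S.law :=
    Integrable.of_bound hm0.aestronglyMeasurable 1 (ae_of_all _ fun o => by
      rw [Real.norm_eq_abs, abs_of_nonneg (S.ellAt_nonneg _ _)]; exact S.ellAt_le_one _ _)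
  have hi1 : Integrable (S.obsCost N cov f) S.law :=
    Integrable.of_bound (S.measurable_obsCost hcov f).aestronglyMeasurable 1
      (ae_of_all _ fun o => S.abs_obsCost_le_one hN cov f o)
  have hi2 : Integrable (fun o : S.Obs => (S.ell o.2.2 (f.1 o.1) : ℝ)) S.law :=
    Integrable.of_bound (S.measurable_ell f).aestronglyMeasurable 1
      (ae_of_all _ fun o => S.abs_ell_le_one _ _)
  have h1 : S.loss f ≤ ∫ o, (S.obsCost N cov f o
      + S.ellAt (S.lower N cov o.2.2) (1 / (2 * (N : ℝ))) + 1 / N) ∂S.law := by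
    refine integral_mono hi2 ((hi1.add hi0).add (integrable_const _)) fun o => ?_
    have := (abs_le.1 (S.abs_obsCost_add_ellAt_sub_ell_le hN hcov f o)).1
    dsimp only
    linarith
  have h3 : ∫ o, (S.obsCost N cov f o
      + S.ellAt (S.lower N cov o.2.2) (1 / (2 * (N : ℝ))) + 1 / N) ∂S.law = _ :=
    integral_add (hi1.add hi0) (integrable_const _)
  have h4 : ∫ o, (S.obsCost N cov f o
      + S.ellAt (S.lower N cov o.2.2) (1 / (2 * (N : ℝ)))) ∂S.law = _ := integral_add hi1 hi0
  rw [h3, h4, integral_const, probReal_univ, one_smul] at h1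
  have h2 := (abs_le.1 h).1
  linarith

/-- If the problem is feasible, then with high probability a near-optimal feasible distribution
satisfies the sample constraint, up to the discretization error and Hoeffding's bound. -/
lemma exists_nearOptimal {n N : ℕ} (hn : 0 < n) (hN : 0 < N) {cov : Finset S.outcomes}
    (hcov : S.IsCover N cov) {t s : ℝ} (ht : 0 ≤ t) (hs : 0 < s) :
    ∃ H : Set (Fin n → S.Obs), S.sampleLaw n H ≤ ENNReal.ofReal (Real.exp (-(2 * n * t ^ 2))) ∧
      ∀ ω ∉ H, ∀ Q, S.Feasible Q → ∃ Q', mean Q' S.disparity ≤ mean Q S.disparity + s ∧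
        mean Q' (S.empCost N cov ω) + S.empC0 N cov ω ≤ S.tol + t + 1 / N := by
  by_cases hex : ∃ Q, S.Feasible Q
  swap
  · exact ⟨∅, by simp, fun ω _ Q hQ => (hex ⟨Q, hQ⟩).elim⟩
  set V : Set ℝ := (fun Q => mean Q S.disparity) '' {Q | S.Feasible Q} with hV
  have hVne : V.Nonempty := hex.elim fun Q hQ => ⟨_, Q, hQ, rfl⟩
  have hVb : BddBelow V := by
    refine ⟨-(|S.β 0| + |S.β 1|), ?_⟩
    rintro _ ⟨Q, _, rfl⟩
    exact (abs_le.1 (abs_mean_le Q S.abs_disparity_le)).1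
  -- The infimum may not be attained, hence the margin `s`. The chosen `Q'` does not depend on the
  -- sample, so Hoeffding's inequality for the single function `g` suffices.
  obtain ⟨_, ⟨Q', hQ', rfl⟩, hlt⟩ := exists_lt_of_csInf_lt hVne (lt_add_of_pos_right (sInf V) hs)
  set g : S.Obs → ℝ := fun o => mean Q' fun f => (S.ell o.2.2 (f.1 o.1) : ℝ) with hg
  have hell : ∀ (f : S.predictors) (o : S.Obs), |(S.ell o.2.2 (f.1 o.1) : ℝ)| ≤ 1 := fun f o =>
    S.abs_ell_le_one _ _
  have hgm : Measurable g := measurable_mean Q' (fun f => S.measurable_ell f) hell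
  have hg01 : ∀ o, g o ∈ Icc (0 : ℝ) 1 := fun o =>
    ⟨tsum_nonneg fun f => mul_nonneg ENNReal.toReal_nonneg (S.ell _ _).2.1,
      (le_abs_self _).trans (abs_mean_le Q' fun f => hell f o)⟩
  have hgi : ∫ o, g o ∂S.law = mean Q' S.loss :=
    integral_mean Q' S.law (fun f => S.measurable_ell f) hell
  refine ⟨_, measure_average_ge_le S.law hgm hg01 hn ht, fun ω hω Q hQ => ⟨Q', ?_, ?_⟩⟩
  · have := csInf_le hVb ⟨Q, hQ, rfl⟩
    linarith
  · have h1 : (∑ i, g (ω i)) / n < S.tol + t := by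
      rw [mem_ofPred_eq, not_le, hgi] at hω
      have : mean Q' S.loss ≤ S.tol := hQ'
      linarith
    have h2 : (∑ i, g (ω i)) / n
        = mean Q' fun f => (∑ i, (S.ell (ω i).2.2 (f.1 (ω i).1) : ℝ)) / n := by
      rw [mean_div_const, mean_finsetSum Q' Finset.univ (M := 1) fun i f => hell f (ω i)]
    have h3 := mean_le_mean_add Q' (g := S.empCost N cov ω)
      (h := fun f => (∑ i, (S.ell (ω i).2.2 (f.1 (ω i).1) : ℝ)) / n)
      (t := 1 / N - S.empC0 N cov ω) (S.abs_empCost_le_one hN cov ω)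
      (fun f => abs_sum_fin_div_le zero_le_one fun i => hell f (ω i)) (fun f => by
        have h4 := abs_sum_fin_div_le (n := n) (M := 1 / N) (by positivity) fun i =>
          S.abs_obsCost_add_ellAt_sub_ell_le hN hcov f (ω i)
        have h5 := (abs_le.1 h4).2
        rw [Finset.sum_sub_distrib, Finset.sum_add_distrib, sub_div, add_div] at h5
        rw [empCost_eq, empC0]
        linarith)
    linarith

end Setting

/-! ### The guarantee -/

namespace Setting

lemma deviation_nonneg {C : ℝ} (hC : 0 ≤ C) (φ δ : ℝ) (m : ℕ) : 0 ≤ deviation C φ δ m := by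
  unfold deviation
  positivity

/-- For `φ ≤ 1/2` the sampling rate `m^(-1/2)` is absorbed by `m^(-φ)`. -/
lemma deviation_le {C φ δ : ℝ} (hφ : φ ≤ 1 / 2) {m : ℕ} (hm : 1 ≤ m) :
    deviation C φ δ m ≤ (2 * C + √(8 * Real.log (1 / δ))) * (m : ℝ) ^ (-φ) := by
  have hm' : (1 : ℝ) ≤ m := by exact_mod_cast hm
  have h : (√(m : ℝ))⁻¹ ≤ (m : ℝ) ^ (-φ) := by
    rw [Real.sqrt_eq_rpow, ← Real.rpow_neg (by positivity)]
    exact Real.rpow_le_rpow_of_exponent_le hm' (by linarith)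
  rw [deviation, Real.sqrt_div' _ (by positivity), div_eq_mul_inv, add_mul, mul_assoc]
  gcongr

variable {𝒳 : Type u} [MeasurableSpace 𝒳] (S : Setting 𝒳)

/-- With probability at least `1 - δ` the loss and the group means are close to their sample
versions, uniformly over the class, and a near-optimal feasible distribution satisfies the sample
constraint. -/
lemma exists_good_event {C φ : ℝ} (hC : 0 ≤ C)
    (hmeas : ∀ z ∈ Icc (0 : ℝ) 1,
      MeasurableClass ((fun f x => threshold f x z) '' S.predictors) (S.law.map Prod.fst))
    (hR : ∀ m : ℕ, 1 ≤ m →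
      rademacherComplexity (thresholdClass S.predictors) m ≤ C * (m : ℝ) ^ (-φ))
    {n N : ℕ} (hn : 0 < n) (hN : 0 < N) {cov : Finset S.outcomes} (hcov : S.IsCover N cov)
    {δ : ℝ} (hδ0 : 0 < δ) (hδ1 : δ < 1) {t s : ℝ} (ht : 0 ≤ t)
    (htδ : Real.exp (-(2 * n * t ^ 2)) ≤ δ / 8) (hs : 0 < s) :
    ∃ U : Set (Fin n → S.Obs), S.sampleLaw n U ≤ ENNReal.ofReal δ ∧ ∀ ω ∉ U,
      (∀ f, S.loss f ≤ S.empCost N cov ω f + S.empC0 N cov ω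
        + deviation C φ (δ / (8 * N)) n + t + 1 / N) ∧
      (∀ a, S.β a ≠ 0 → 0 < (S.group ω a).card → ∀ f, |S.groupAverage N ω a f - S.groupMean a f|
        ≤ deviation C φ (δ / (8 * N)) (S.group ω a).card + 1 / N) ∧
      ∀ Q, S.Feasible Q → ∃ Q', mean Q' S.disparity ≤ mean Q S.disparity + s ∧
        mean Q' (S.empCost N cov ω) + S.empC0 N cov ω ≤ S.tol + t + 1 / N := by
  have hN' : (0 : ℝ) < N := by exact_mod_cast hN
  have hN1 : (1 : ℝ) ≤ N := by exact_mod_cast hN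
  set δ' := δ / (8 * N) with hδ'
  have hδ'0 : 0 < δ' := by positivity
  have hδ'1 : δ' ≤ 1 := by
    rw [hδ', div_le_one (by positivity)]
    linarith
  have hgrid : ∀ j ∈ Finset.Icc 1 N, ((j : ℝ) / N) ∈ Icc (0 : ℝ) 1 := by
    intro j hj
    rw [Finset.mem_Icc] at hj
    refine ⟨by positivity, ?_⟩
    rw [div_le_one hN']
    exact_mod_cast hj.2
  have hsum : ∀ V : ℕ → Set (Fin n → S.Obs),
      (∀ j ∈ Finset.Icc 1 N, S.sampleLaw n (V j) ≤ ENNReal.ofReal δ') →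
      S.sampleLaw n (⋃ j ∈ Finset.Icc 1 N, V j) ≤ ENNReal.ofReal (δ / 8) := by
    intro V hV
    refine (measure_biUnion_finset_le _ _).trans ((Finset.sum_le_sum hV).trans (le_of_eq ?_))
    rw [Finset.sum_const, Nat.card_Icc, add_tsub_cancel_right, ← ENNReal.ofReal_nsmul,
      nsmul_eq_mul, hδ']
    congr 1
    field_simp
  set VL : ℕ → Set (Fin n → S.Obs) := fun j => {ω | ∃ f : S.predictors, deviation C φ δ' n ≤
    |(∑ i, S.c N (S.lower N cov (ω i).2.2) ((j : ℝ) / N) * threshold f.1 (ω i).1 ((j : ℝ) / N)) / n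
      - ∫ o, S.c N (S.lower N cov o.2.2) ((j : ℝ) / N) * threshold f.1 o.1 ((j : ℝ) / N) ∂S.law|}
    with hVL
  have hL : S.sampleLaw n (⋃ j ∈ Finset.Icc 1 N, VL j) ≤ ENNReal.ofReal (δ / 8) := by
    refine hsum _ fun j hj => ?_
    have h := S.measure_threshold_deviation_le (κ := Fin n) hR (hgrid j hj) (hmeas _ (hgrid j hj))
      (w := fun o : S.Obs => S.c N (S.lower N cov o.2.2) ((j : ℝ) / N))
      ((S.measurable_comp_lower hcov fun y => S.c N y ((j : ℝ) / N)).comp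
        (measurable_snd.comp measurable_snd))
      (S.finite_range_comp_lower hcov fun y => S.c N y ((j : ℝ) / N))
      (fun o => S.abs_c_le_one hN _ _) S.law Measure.AbsolutelyContinuous.rfl (by simpa using hn)
      hδ'0 hδ'1
    rwa [Fintype.card_fin] at h
  set VG : Fin 2 → ℕ → Set (Fin n → S.Obs) := fun a j => {ω | 0 < (S.group ω a).card ∧
    ∃ f : S.predictors, deviation C φ δ' (S.group ω a).card ≤
      |(∑ i ∈ S.group ω a, threshold f.1 (ω i).1 ((j : ℝ) / N)) / (S.group ω a).card
        - ∫ o, threshold f.1 o.1 ((j : ℝ) / N) ∂(S.law[|{o | o.2 ∈ S.event a}])|} with hVG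
  -- A group with zero coefficient is left out: its event may have probability zero, and then there
  -- is no conditional law.
  set UG : Fin 2 → Set (Fin n → S.Obs) := fun a =>
    {ω | S.β a ≠ 0 ∧ ω ∈ ⋃ j ∈ Finset.Icc 1 N, VG a j} with hUG
  have hG : ∀ a, S.sampleLaw n (UG a) ≤ ENNReal.ofReal (δ / 8) := by
    intro a
    by_cases ha : S.β a = 0
    · simp [hUG, ha]
    · refine (measure_mono fun ω hω => hω.2).trans (hsum _ fun j hj => ?_)
      exact S.measure_group_deviation_le hR (hgrid j hj) (hmeas _ (hgrid j hj)) (S.event_pos a ha) n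
        hδ'0 hδ'1
  have hgm0 : Measurable fun o : S.Obs => S.ellAt (S.lower N cov o.2.2) (1 / (2 * (N : ℝ))) :=
    (S.measurable_comp_lower hcov fun y => S.ellAt y (1 / (2 * (N : ℝ)))).comp
      (measurable_snd.comp measurable_snd)
  have hgi0 : Integrable (fun o : S.Obs => S.ellAt (S.lower N cov o.2.2) (1 / (2 * (N : ℝ)))) S.law :=
    Integrable.of_bound hgm0.aestronglyMeasurable 1 (ae_of_all _ fun o => by
      rw [Real.norm_eq_abs, abs_of_nonneg (S.ellAt_nonneg _ _)]; exact S.ellAt_le_one _ _)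
  -- The lower tail of `ĉ₀` is the upper tail for `1 - l`.
  have h0 := (measure_average_ge_le S.law (hgm0.const_sub 1) (fun o =>
    ⟨sub_nonneg.2 (S.ellAt_le_one _ _), sub_le_self _ (S.ellAt_nonneg _ _)⟩) hn ht).trans
      (ENNReal.ofReal_le_ofReal htδ)
  set U0 := {ω : Fin n → S.Obs | ∫ o, (1 - S.ellAt (S.lower N cov o.2.2) (1 / (2 * (N : ℝ)))) ∂S.law
    + t ≤ (∑ i, (1 - S.ellAt (S.lower N cov (ω i).2.2) (1 / (2 * (N : ℝ))))) / n} with hU0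
  obtain ⟨H, hH, hHω⟩ := S.exists_nearOptimal hn hN hcov ht hs
  -- Five events of probability at most `δ / 8`: cost, two groups, `ĉ₀`, and the competitor's loss.
  -- The level `δ / (8 N)` per threshold pays for the union over the grid.
  refine ⟨(⋃ j ∈ Finset.Icc 1 N, VL j) ∪ UG 0 ∪ UG 1 ∪ U0 ∪ H, ?_, fun ω hω => ?_⟩
  · have h1 : S.sampleLaw n ((⋃ j ∈ Finset.Icc 1 N, VL j) ∪ UG 0 ∪ UG 1 ∪ U0 ∪ H)
        ≤ ENNReal.ofReal (δ / 8) + ENNReal.ofReal (δ / 8) + ENNReal.ofReal (δ / 8)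
          + ENNReal.ofReal (δ / 8) + ENNReal.ofReal (δ / 8) := by
      refine (measure_union_le _ _).trans (add_le_add ?_ (hH.trans (ENNReal.ofReal_le_ofReal htδ)))
      refine (measure_union_le _ _).trans (add_le_add ?_ h0)
      refine (measure_union_le _ _).trans (add_le_add ?_ (hG 1))
      exact (measure_union_le _ _).trans (add_le_add hL (hG 0))
    refine h1.trans ?_
    have h8 : 0 ≤ δ / 8 := by positivity
    rw [← ENNReal.ofReal_add h8 h8, ← ENNReal.ofReal_add (by positivity) h8,
      ← ENNReal.ofReal_add (by positivity) h8, ← ENNReal.ofReal_add (by positivity) h8]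
    exact ENNReal.ofReal_le_ofReal (by linarith)
  · simp only [mem_union, not_or] at hω
    obtain ⟨⟨⟨⟨hω1, hω2⟩, hω3⟩, hω4⟩, hω5⟩ := hω
    refine ⟨fun f => ?_, fun a ha hcard f => ?_, hHω ω hω5⟩
    · refine S.loss_le hN hcov f (S.abs_empCost_sub_integral_le hcov
        (deviation_nonneg hC _ _ _) f fun j hj => ?_) ?_
      · by_contra hcon
        exact hω1 (mem_biUnion hj ⟨f, (not_le.1 hcon).le⟩)
      · rw [hU0, mem_ofPred_eq, not_le, integral_sub (integrable_const _) hgi0, integral_const,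
          probReal_univ, one_smul, Finset.sum_sub_distrib, sub_div] at hω4
        have h2 : (∑ _i : Fin n, (1 : ℝ)) / n = 1 := by
          have : (n : ℝ) ≠ 0 := by exact_mod_cast hn.ne'
          simp [this]
        rw [h2] at hω4
        rw [empC0]
        linarith
    · have hnot : ω ∉ UG a := by
        fin_cases a
        exacts [hω2, hω3]
      refine S.abs_groupAverage_sub_groupMean_le hN (S.event_pos a ha)
        (deviation_nonneg hC _ _ _) f fun j hj => ?_
      by_contra hcon
      exact hnot ⟨ha, mem_biUnion hj ⟨hcard, f, (not_le.1 hcon).le⟩⟩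

/-- The coefficient stays inside the deviation, so a group with zero coefficient is harmless even if
its averages are uncontrolled. -/
lemma abs_mean_empDisparity_sub_le {n N : ℕ} {ω : Fin n → S.Obs} {e : Fin 2 → ℝ}
    (he : ∀ a f, |S.β a * S.groupAverage N ω a f - S.β a * S.groupMean a f| ≤ e a)
    (Q : PMF S.predictors) :
    mean Q (S.empDisparity N ω) ≤ mean Q S.disparity + (e 0 + e 1) ∧
      mean Q S.disparity ≤ mean Q (S.empDisparity N ω) + (e 0 + e 1) := by
  constructor
  · refine mean_le_mean_add Q (S.abs_empDisparity_le N ω) S.abs_disparity_le fun f => ?_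
    rw [empDisparity_eq, disparity_eq]
    linarith [(abs_le.1 (he 0 f)).2, (abs_le.1 (he 1 f)).2]
  · refine mean_le_mean_add Q S.abs_disparity_le (S.abs_empDisparity_le N ω) fun f => ?_
    rw [empDisparity_eq, disparity_eq]
    linarith [(abs_le.1 (he 0 f)).1, (abs_le.1 (he 1 f)).1]

/-- The number of iterations of the algorithm. -/
lemma exists_returns_egInput {n N : ℕ} {cov : Finset S.outcomes} {B ν e : ℝ} {best : ℝ → S.predictors}
    {ω : Fin n → S.Obs} {I : EGInput S.predictors} (hI : I = S.egInput N cov B ν e best ω)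
    (hbest : I.IsBestResponse) (hB : 0 < B) (hν : 0 < ν) {M : ℝ} (hM : 0 ≤ M)
    (hcost : ∀ f, |S.empCost N cov ω f - e| ≤ M) :
    ∃ T out, I.Returns T out ∧ (T : ℝ) ≤ 4 * M ^ 2 * B ^ 2 * Real.log 2 / ν ^ 2 + 1 := by
  subst hI
  set ρ := ⨆ f : S.predictors, |S.empCost N cov ω f - e| with hρ
  have hρ0 : 0 ≤ ρ := Real.iSup_nonneg fun _ => abs_nonneg _
  have hρM : ρ ≤ M := Real.iSup_le hcost hM
  have hbdd : BddAbove (range fun f : S.predictors => |S.empCost N cov ω f - e|) :=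
    ⟨M, by rintro _ ⟨f, rfl⟩; exact hcost f⟩
  obtain ⟨T, out, h1, h2⟩ := (S.egInput N cov B ν e best ω).exists_returns hbest
    (fun f => le_ciSup hbdd f) hρ0 hB hν rfl
  refine ⟨T, out, h1, h2.trans ?_⟩
  have := Real.log_nonneg one_le_two
  have hsq : ρ ^ 2 ≤ M ^ 2 := pow_le_pow_left₀ hρ0 hρM 2
  change 4 * ρ ^ 2 * B ^ 2 * Real.log 2 / ν ^ 2 + 1 ≤ _
  gcongr

/-- A distribution that is almost as good as a near-optimal one on the sample is almost as good
as every feasible distribution on the population. -/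
lemma mean_disparity_le {n N : ℕ} {ω : Fin n → S.Obs} {φ b c κ s : ℝ} (hφ : 0 ≤ φ)
    (hs : s = (n : ℝ) ^ (-φ)) (hβ : ∀ a, |S.β a| ≤ b) (hc : 0 ≤ c) (hκ : 0 ≤ κ)
    (hcard : ∀ a, S.β a ≠ 0 → 0 < (S.group ω a).card)
    (hgroup : ∀ a, S.β a ≠ 0 → ∀ f, |S.groupAverage N ω a f - S.groupMean a f|
      ≤ c * ((S.group ω a).card : ℝ) ^ (-φ) + c * s) {Q Q' Q'' : PMF S.predictors}
    (hQ : mean Q (S.empDisparity N ω) ≤ mean Q'' (S.empDisparity N ω) + κ * s)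
    (hQ'' : mean Q'' S.disparity ≤ mean Q' S.disparity + s) :
    mean Q S.disparity ≤ mean Q' S.disparity
      + (1 + κ + 4 * b * c) * (((S.group ω 0).card : ℝ) ^ (-φ) + ((S.group ω 1).card : ℝ) ^ (-φ)) := by
  set p : Fin 2 → ℝ := fun a => ((S.group ω a).card : ℝ) ^ (-φ) with hp
  -- For an empty group `0 ^ (-φ)` is `0` when `φ > 0` and `1` when `φ = 0`; only nonnegativity is
  -- used in that case.
  have hp0 : ∀ a, 0 ≤ p a := fun a => by positivity
  have hb : 0 ≤ b := (abs_nonneg _).trans (hβ 0)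
  change _ ≤ _ + (1 + κ + 4 * b * c) * (p 0 + p 1)
  have hsp : ∀ a, S.β a ≠ 0 → s ≤ p a := by
    intro a ha
    have h3 : (0 : ℝ) < (S.group ω a).card := by exact_mod_cast hcard a ha
    rw [hs]
    refine Real.rpow_le_rpow_of_nonpos h3 ?_ (by linarith)
    exact_mod_cast (Finset.card_le_univ _).trans_eq (Fintype.card_fin n)
  have he : ∀ a f, |S.β a * S.groupAverage N ω a f - S.β a * S.groupMean a f|
      ≤ b * (2 * c * p a) := by
    intro a f
    by_cases ha : S.β a = 0
    · rw [ha, zero_mul, zero_mul, sub_zero, abs_zero]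
      have := hp0 a
      positivity
    · rw [← mul_sub, abs_mul]
      have h1 : c * s ≤ c * p a := mul_le_mul_of_nonneg_left (hsp a ha) hc
      exact mul_le_mul (hβ a) ((hgroup a ha f).trans (by linarith)) (abs_nonneg _) hb
  -- Bounding `s` by the group terms requires a nonempty group, which is guaranteed only if some
  -- coefficient is nonzero; otherwise all disparities vanish.
  by_cases hzero : ∀ a, S.β a = 0
  · have h6 : ∀ R : PMF S.predictors, mean R S.disparity = 0 := fun R => by
      rw [show S.disparity = fun _ => 0 from funext fun f => by simp [S.disparity_eq, hzero], mean_const]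
    rw [h6, h6]
    have := hp0 0
    have := hp0 1
    positivity
  · push Not at hzero
    obtain ⟨a, ha⟩ := hzero
    have h5 : s ≤ p 0 + p 1 := by
      have h6 := hsp a ha
      have h7 := hp0 0
      have h8 := hp0 1
      fin_cases a <;> simp at h6 <;> linarith
    have h3 := (S.abs_mean_empDisparity_sub_le he Q).2
    have h4 := (S.abs_mean_empDisparity_sub_le he Q'').1
    have h6 : (1 + κ) * s ≤ (1 + κ) * (p 0 + p 1) := mul_le_mul_of_nonneg_left h5 (by linarith)
    linarith

end Setting

/-- The logarithmic factor absorbs `√(8 log (8 N / δ))`. -/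
lemma sqrt_log_le {φ κN δ : ℝ} (hφ : φ ≤ 1 / 2) (hκN : 0 < κN) {n N : ℕ} (hn : 1 ≤ n)
    (hN : 0 < N) (hNle : (N : ℝ) ≤ κN * (n : ℝ) ^ φ) (hδ0 : 0 < δ) (hδ1 : δ < 1) :
    √(8 * Real.log (1 / (δ / (8 * N))))
      ≤ 8 * (3 + |Real.log κN|) * (1 + Real.log n + Real.log (1 / δ)) := by
  have hn' : (1 : ℝ) ≤ n := by exact_mod_cast hn
  have hN' : (0 : ℝ) < N := by exact_mod_cast hN
  have hln : 0 ≤ Real.log n := Real.log_nonneg hn'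
  have hlδ : 0 ≤ Real.log (1 / δ) := Real.log_nonneg (one_le_one_div hδ0 hδ1.le)
  have hl8 : Real.log 8 ≤ 3 := by
    rw [show (8 : ℝ) = 2 ^ 3 by norm_num, Real.log_pow]
    have := Real.log_two_lt_d9
    push_cast
    linarith
  have hlN : Real.log N ≤ |Real.log κN| + Real.log n := by
    have h1 := Real.log_le_log hN' hNle
    rw [Real.log_mul hκN.ne' (by positivity), Real.log_rpow (by linarith)] at h1
    have h2 : φ * Real.log n ≤ 1 * Real.log n := by gcongr; linarith
    linarith [le_abs_self (Real.log κN)]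
  set X := 1 + Real.log n + Real.log (1 / δ) with hX
  have hX1 : 1 ≤ X := by linarith
  have hlog : Real.log (1 / (δ / (8 * N))) ≤ (3 + |Real.log κN|) * X := by
    rw [one_div_div, mul_div_assoc, mul_comm, div_eq_mul_one_div, Real.log_mul (by positivity) (by norm_num),
      Real.log_mul (by positivity) (by positivity)]
    nlinarith [abs_nonneg (Real.log κN)]
  -- The bound is at least `1`, hence at most its own square, so it may be used without the square
  -- root.
  have hge : 1 ≤ 8 * (3 + |Real.log κN|) * X := by nlinarith [abs_nonneg (Real.log κN)]
  refine Real.sqrt_le_iff.2 ⟨by linarith, ?_⟩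
  nlinarith

lemma sq_sqrt_neg_log {δ : ℝ} (hδ0 : 0 < δ) (hδ1 : δ < 1) :
    √(-Real.log (δ / 8) / 2) ^ 2 = -Real.log (δ / 8) / 2 := by
  have : Real.log (δ / 8) ≤ 0 := Real.log_nonpos (by positivity) (by linarith)
  exact Real.sq_sqrt (by linarith)

/-- The logarithm in the lower bound on `C'` enters the choice of slack only by dominating `2 b_δ`.
-/
lemma two_mul_sqrt_log_le {δ : ℝ} (hδ0 : 0 < δ) (hδ1 : δ < 1) {N : ℕ} (hN : 0 < N) :
    2 * √(-Real.log (δ / 8) / 2) ≤ √(2 * Real.log (8 * N / δ)) := by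
  have hN1 : (1 : ℝ) ≤ N := by exact_mod_cast hN
  refine Real.le_sqrt_of_sq_le ?_
  have h1 : Real.log (8 / δ) ≤ Real.log (8 * N / δ) := by
    refine Real.log_le_log (by positivity) ?_
    gcongr
    linarith
  have h2 : Real.log (8 / δ) = -Real.log (δ / 8) := by rw [← Real.log_inv, inv_div]
  rw [mul_pow, sq_sqrt_neg_log hδ0 hδ1]
  linarith

/-- The constant `b_δ` is chosen so that the Hoeffding tail at `b_δ n^(-1/2)` equals `δ / 8`. -/
lemma exp_neg_sqrt_log_le {δ : ℝ} (hδ0 : 0 < δ) (hδ1 : δ < 1) {n : ℕ} (hn : 1 ≤ n) :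
    Real.exp (-(2 * n * (√(-Real.log (δ / 8) / 2) * (n : ℝ) ^ (-(1 / 2) : ℝ)) ^ 2)) ≤ δ / 8 := by
  have hn0 : (0 : ℝ) < n := by exact_mod_cast hn
  have h1 : ((n : ℝ) ^ (-(1 / 2) : ℝ)) ^ 2 * n = 1 := by
    rw [← Real.rpow_natCast, ← Real.rpow_mul hn0.le]
    norm_num
    rw [Real.rpow_neg_one, inv_mul_cancel₀ hn0.ne']
  rw [mul_pow, sq_sqrt_neg_log hδ0 hδ1, show -(2 * n * (-Real.log (δ / 8) / 2
    * ((n : ℝ) ^ (-(1 / 2) : ℝ)) ^ 2)) = Real.log (δ / 8) * (((n : ℝ) ^ (-(1 / 2) : ℝ)) ^ 2 * n) by ring,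
    h1, mul_one, Real.exp_log (by positivity)]

end FairRashomon

/-! ### Choice of constants and assembly of the theorem -/

set_option maxHeartbeats 800000 in
theorem theorem1 (φ C b κν κB κN : ℝ) (hφ0 : 0 ≤ φ) (hφ : φ ≤ 1 / 2) (hC : 0 < C)
    (hκν : 0 < κν) (hκB : 0 < κB) (hκN : 0 < κN) :
    -- constants depending only on the parameters above
    ∃ (K : ℝ) (p : ℕ), 0 < K ∧
      ∀ (𝒳 : Type u) [MeasurableSpace 𝒳] (S : FairRashomon.Setting 𝒳),
        |S.β 0| + |S.β 1| ≤ b →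
        (∀ z ∈ Icc (0 : ℝ) 1, FairRashomon.MeasurableClass
          ((fun f x => FairRashomon.threshold f x z) '' S.predictors) (S.law.map Prod.fst)) →
        (∀ m : ℕ, 1 ≤ m → FairRashomon.rademacherComplexity
          (FairRashomon.thresholdClass S.predictors) m ≤ C * (m : ℝ) ^ (-φ)) →
      ∀ (n : ℕ), 1 ≤ n → ∀ (δ : ℝ), 0 < δ → δ < 1 →
      ∀ (N : ℕ), (n : ℝ) ^ φ ≤ (2 * C + 2) * N → (N : ℝ) ≤ κN * (n : ℝ) ^ φ →
      ∀ (cov : Finset S.outcomes), S.IsCover N cov →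
      ∀ (C' C'' : ℝ), √(-Real.log (δ / 8) / 2) ≤ C'' →
        2 * C + 2 + √(2 * Real.log (8 * N / δ)) + (C'' - √(-Real.log (δ / 8) / 2)) ≤ C' →
      ∀ (best : (Fin n → S.Obs) → ℝ → S.predictors),
      -- the run of the algorithm on the sample `ω`
      ∀ (run : (Fin n → S.Obs) → FairRashomon.EGInput S.predictors),
        (∀ ω, run ω = S.egInput N cov (κB * (n : ℝ) ^ φ) (κν * (n : ℝ) ^ (-φ))
          (S.epsHat N cov φ C' C'' ω) (best ω) ω) →
        (∀ ω, (run ω).IsBestResponse) →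
        -- the number of iterations, on every sample
        (∀ ω, ∃ T out, (run ω).Returns T out ∧
          (T : ℝ) ≤ K * (1 + S.tol + C' * (n : ℝ) ^ (-φ) + C'' * (n : ℝ) ^ (-(1 / 2) : ℝ)) ^ 2
            * (n : ℝ) ^ (4 * φ)) ∧
        -- the guarantee fails with (outer) probability at most `δ`
        S.sampleLaw n {ω | ¬ ∃ T out, (run ω).Returns T out ∧
          S.Guarantee φ
            ((C' + K * (1 + Real.log n + Real.log (1 / δ)) ^ p) * (n : ℝ) ^ (-φ))
            (K * (1 + Real.log n + Real.log (1 / δ)) ^ p) ω out}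
          ≤ ENNReal.ofReal δ := by
  have hlog2 : 0 ≤ Real.log 2 := Real.log_nonneg one_le_two
  set c₁ := 8 * (3 + |Real.log κN|) with hc₁
  have hc₁0 : 0 ≤ c₁ := by positivity
  set D := 2 * C + c₁ with hD
  -- `K₁` serves the loss: tolerated violation, deviation, grid error. `K₂` serves the disparity:
  -- near-optimality margin, saddle gap, group deviations. `K₃` serves the iteration count, with `ρ
  -- ≤ 2 G`. The absolute value keeps them nonnegative before `b ≥ 0` is known.
  set K₁ := (|b| + 2 * κν) / κB + D + (2 * C + 2) with hK₁
  set K₂ := 1 + 2 * κν + 4 * |b| * (D + (2 * C + 2)) with hK₂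
  set K₃ := 16 * Real.log 2 * κB ^ 2 / κν ^ 2 + 1 with hK₃
  have hK₁0 : 0 ≤ K₁ := by positivity
  have hK₂0 : 0 ≤ K₂ := by positivity
  have hK₃0 : 0 < K₃ := by positivity
  refine ⟨K₁ + K₂ + K₃, 1, by positivity, ?_⟩
  intro 𝒳 _ S hb hmeas hR n hn δ hδ0 hδ1 N hNge hNle cov hcov C' C'' hC'' hC' best run hrun hbest
  have hn1 : (1 : ℝ) ≤ n := by exact_mod_cast hn
  have hn0 : (0 : ℝ) < n := by linarith
  set s := (n : ℝ) ^ (-φ) with hs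
  set r := (n : ℝ) ^ (-(1 / 2) : ℝ) with hr
  set q := (n : ℝ) ^ φ with hq
  have hs0 : 0 < s := by positivity
  have hr0 : 0 < r := by positivity
  have hq0 : 0 < q := by positivity
  have hqs : q * s = 1 := by rw [hq, hs, ← Real.rpow_add hn0]; simp
  have hrs : r ≤ s := Real.rpow_le_rpow_of_exponent_le hn1 (by linarith)
  have hs1 : s ≤ 1 := Real.rpow_le_one_of_one_le_of_nonpos hn1 (by linarith)
  have hN : 0 < N := by
    rcases Nat.eq_zero_or_pos N with rfl | h
    · simp at hNge; linarith
    · exact h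
  have hN' : (0 : ℝ) < N := by exact_mod_cast hN
  have hNs : 1 / (N : ℝ) ≤ (2 * C + 2) * s := by
    rw [div_le_iff₀ hN']
    calc (1 : ℝ) = q * s := hqs.symm
      _ ≤ (2 * C + 2) * N * s := by gcongr
      _ = _ := by ring
  set bδ := √(-Real.log (δ / 8) / 2) with hbδ
  have hbδ0 : 0 ≤ bδ := Real.sqrt_nonneg _
  have hC''0 : 0 ≤ C'' := hbδ0.trans hC''
  have h2bδ : 2 * bδ ≤ √(2 * Real.log (8 * N / δ)) := FairRashomon.two_mul_sqrt_log_le hδ0 hδ1 hN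
  have hC'0 : 0 ≤ C' := by linarith
  -- The tolerance exceeds `ε - ĉ₀` by enough to cover the grid error and Hoeffding's term; `r ≤ s`
  -- lets `(C'' + b_δ) s` pay for `(C'' + b_δ) r`.
  have hslack : 1 / (N : ℝ) + bδ * r ≤ C' * s - C'' * r := by
    have h1 : (2 * C + 2 + 2 * bδ + (C'' - bδ)) * s ≤ C' * s := by gcongr; linarith
    have h2 : (C'' + bδ) * r ≤ (C'' + bδ) * s := by gcongr
    linarith
  set X := 1 + Real.log n + Real.log (1 / δ) with hX
  have hX1 : 1 ≤ X := by
    have := Real.log_nonneg hn1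
    have := Real.log_nonneg (one_le_one_div hδ0 hδ1.le)
    linarith
  have hdev : ∀ m : ℕ, 1 ≤ m →
      FairRashomon.Setting.deviation C φ (δ / (8 * N)) m ≤ D * X * (m : ℝ) ^ (-φ) := by
    intro m hm
    refine (FairRashomon.Setting.deviation_le hφ hm).trans ?_
    gcongr
    have := FairRashomon.sqrt_log_le hφ hκN hn hN hNle hδ0 hδ1
    rw [hD, add_mul]
    have h2 : 2 * C ≤ 2 * C * X := le_mul_of_one_le_right (by positivity) hX1
    linarith
  have hb0 : 0 ≤ b := le_trans (by positivity) hb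
  have hβ : ∀ a, |S.β a| ≤ b := by
    intro a
    have h0 := abs_nonneg (S.β 0)
    have h1 := abs_nonneg (S.β 1)
    fin_cases a <;> simp <;> linarith
  rw [abs_of_nonneg hb0] at hK₁ hK₂
  -- the components of the input of the algorithm
  have hdisp : ∀ ω, (run ω).disp = S.empDisparity N ω := fun ω => by rw [hrun]; rfl
  have hcost : ∀ ω, (run ω).cost = S.empCost N cov ω := fun ω => by rw [hrun]; rfl
  have hweight : ∀ ω, (run ω).weight = |S.β 0| + |S.β 1| := fun ω => by rw [hrun]; rfl
  have heps : ∀ ω, (run ω).epsHat = S.tol - S.empC0 N cov ω + C' * s - C'' * r := fun ω => by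
    rw [hrun]; rfl
  have hB : ∀ ω, (run ω).B = κB * q := fun ω => by rw [hrun]; rfl
  have hν : ∀ ω, (run ω).ν = κν * s := fun ω => by rw [hrun]; rfl
  have hB0 : ∀ ω, 0 < (run ω).B := fun ω => by rw [hB]; positivity
  have hcostb : ∀ ω f, |(run ω).cost f| ≤ 1 := fun ω f => by
    rw [hcost]; exact S.abs_empCost_le_one hN cov ω f
  have hdispb : ∀ ω f, |(run ω).disp f| ≤ |S.β 0| + |S.β 1| := fun ω f => by
    rw [hdisp]; exact S.abs_empDisparity_le N ω f
  set G := 1 + S.tol + C' * s + C'' * r with hG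
  have htol := S.tol_nonneg
  have hG1 : 1 ≤ G := by
    have : 0 ≤ C' * s := by positivity
    have : 0 ≤ C'' * r := by positivity
    linarith
  have hdevcost : ∀ ω f, |(run ω).cost f - (run ω).epsHat| ≤ 2 * G := by
    intro ω f
    have h1 := abs_le.1 (hcostb ω f)
    have h2 := abs_le.1 (S.abs_empC0_le_one N cov ω)
    have h3 : 0 ≤ C' * s := by positivity
    have h4 : 0 ≤ C'' * r := by positivity
    rw [heps, abs_le]
    constructor <;> linarith [h1.1, h1.2, h2.1, h2.2]
  have hret : ∀ ω, ∃ T out, (run ω).Returns T out ∧ (T : ℝ) ≤ K₃ * G ^ 2 * (n : ℝ) ^ (4 * φ) := by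
    intro ω
    obtain ⟨T, out, h1, h2⟩ := S.exists_returns_egInput (hrun ω) (hbest ω) (by positivity)
      (by positivity) (by linarith : 0 ≤ 2 * G) fun f => by
        have := hdevcost ω f
        rwa [hcost, hrun] at this
    refine ⟨T, out, h1, h2.trans ?_⟩
    have hn4 : (n : ℝ) ^ (4 * φ) = q ^ 4 := by
      rw [hq, mul_comm, ← Real.rpow_natCast, ← Real.rpow_mul hn0.le]
      norm_num
    have hq1 : 1 ≤ q := Real.one_le_rpow hn1 hφ0
    have hsq : s = q⁻¹ := eq_inv_of_mul_eq_one_right hqs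
    calc 4 * (2 * G) ^ 2 * (κB * q) ^ 2 * Real.log 2 / (κν * s) ^ 2 + 1
        = 4 * Real.log 2 * κB ^ 2 / κν ^ 2 * (2 * G) ^ 2 * q ^ 4 + 1 := by rw [hsq]; field_simp
      _ ≤ 4 * Real.log 2 * κB ^ 2 / κν ^ 2 * (2 * G) ^ 2 * q ^ 4 + G ^ 2 * q ^ 4 := by
          gcongr
          exact one_le_mul_of_one_le_of_one_le (one_le_pow₀ hG1) (one_le_pow₀ hq1)
      _ = K₃ * G ^ 2 * (n : ℝ) ^ (4 * φ) := by rw [hK₃, hn4]; ring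
  refine ⟨fun ω => ?_, ?_⟩
  · obtain ⟨T, out, h1, h2⟩ := hret ω
    refine ⟨T, out, h1, h2.trans ?_⟩
    gcongr
    linarith
  have htδ := FairRashomon.exp_neg_sqrt_log_le hδ0 hδ1 hn
  obtain ⟨U, hU, hUω⟩ := S.exists_good_event hC.le hmeas hR hn hN hcov hδ0 hδ1
    (t := bδ * r) (s := s) (by positivity) htδ hs0
  -- Failure is only contained in the exceptional set `U`, which suffices for outer measure.
  refine (measure_mono fun ω hω => ?_).trans hU
  by_contra hωU
  refine hω ?_
  obtain ⟨hloss, hgroup, hopt⟩ := hUω ω hωU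
  obtain ⟨T, out, hTout, _⟩ := hret ω
  refine ⟨T, out, hTout, ?_⟩
  obtain ⟨k, _, hgap, _, rfl⟩ := hTout
  have hfeas : ∀ Q', FairRashomon.mean Q' (S.empCost N cov ω) + S.empC0 N cov ω
      ≤ S.tol + bδ * r + 1 / N → FairRashomon.mean Q' (run ω).cost ≤ (run ω).epsHat := by
    intro Q' hQ'
    rw [hcost, heps]
    linarith
  have hsaddle : ∀ Q', FairRashomon.mean Q' (run ω).cost ≤ (run ω).epsHat → _ := fun Q' hQ' =>
    (run ω).disp_mix_add_le (hbest ω) (hB0 ω).le hgap (hdispb ω) (hcostb ω) hQ'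
  set Q := (run ω).mix k with hQ
  split_ifs with hif
  · refine ⟨?_, fun hcard Q' hQ' => ?_⟩
    · -- loss
      have h1 : FairRashomon.mean Q S.loss ≤ FairRashomon.mean Q (S.empCost N cov ω)
          + (S.empC0 N cov ω + D * X * s + bδ * r + 1 / N) := by
        refine FairRashomon.mean_le_mean_add Q (fun f => FairRashomon.abs_integral_le S.law fun o =>
          S.abs_ell_le_one _ _) (S.abs_empCost_le_one hN cov ω) fun f => (hloss f).trans ?_
        linarith [hdev n hn]
      rw [hcost, heps, hweight, hB, hν] at hif
      have h2 : (|S.β 0| + |S.β 1| + 2 * (κν * s)) / (κB * q) ≤ (b + 2 * κν) / κB * s := by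
        rw [div_mul_eq_mul_div, div_le_div_iff₀ (by positivity) hκB]
        have h3 : |S.β 0| + |S.β 1| + 2 * (κν * s) ≤ b + 2 * κν := by
          have : κν * s ≤ κν := mul_le_of_le_one_right hκν.le hs1
          linarith
        calc _ ≤ (b + 2 * κν) * κB := by gcongr
          _ = (b + 2 * κν) * s * (κB * q) := by linear_combination -(b + 2 * κν) * κB * hqs
      -- The term `-C'' r` in the tolerance cancels the deviation of `ĉ₀`, leaving `C' s` with
      -- coefficient one.
      have h3 : bδ * r ≤ C'' * r := by gcongr
      have h4 : FairRashomon.mean Q S.loss ≤ S.tol + (C' * s + (b + 2 * κν) / κB * s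
          + D * X * s + (2 * C + 2) * s) := by linarith
      refine h4.trans ?_
      rw [pow_one, add_mul]
      have h5 : (b + 2 * κν) / κB * s + D * X * s + (2 * C + 2) * s ≤ K₁ * X * s := by
        have h6 : (b + 2 * κν) / κB ≤ (b + 2 * κν) / κB * X := le_mul_of_one_le_right (by positivity) hX1
        have h7 : 2 * C + 2 ≤ (2 * C + 2) * X := le_mul_of_one_le_right (by positivity) hX1
        rw [← add_mul, ← add_mul, hK₁]
        gcongr
        linarith
      have h6 : K₁ * X * s ≤ (K₁ + K₂ + K₃) * X * s := by
        gcongr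
        linarith
      linarith
    · -- disparity
      obtain ⟨Q'', hQ''1, hQ''2⟩ := hopt Q' hQ'
      have h1 := hsaddle Q'' (hfeas Q'' hQ''2)
      rw [hdisp, hν] at h1
      have h2 : 0 ≤ (run ω).B * max 0 (FairRashomon.mean Q (run ω).cost - (run ω).epsHat) :=
        mul_nonneg (hB0 ω).le (le_max_left _ _)
      have h3 := S.mean_disparity_le hφ0 hs hβ (by positivity : 0 ≤ (D + (2 * C + 2)) * X)
        (by positivity : 0 ≤ 2 * κν) hcard (fun a ha f => (hgroup a ha (hcard a ha) f).trans ?_)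
        (Q := Q) (by linarith) hQ''1
      · have h4 : 1 + 2 * κν + 4 * b * ((D + (2 * C + 2)) * X) ≤ (K₁ + K₂ + K₃) * X := by
          have h5 : 1 + 2 * κν ≤ (1 + 2 * κν) * X := le_mul_of_one_le_right (by positivity) hX1
          have h6 : K₂ * X ≤ (K₁ + K₂ + K₃) * X := by
            gcongr
            linarith
          have h7 : K₂ * X = (1 + 2 * κν) * X + 4 * b * ((D + (2 * C + 2)) * X) := by
            rw [hK₂]; ring
          linarith
        rw [pow_one]
        refine h3.trans ?_
        rw [add_assoc (FairRashomon.mean Q' S.disparity), ← mul_add]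
        gcongr
      · refine add_le_add ((hdev _ (hcard a ha)).trans ?_) (hNs.trans ?_)
        · gcongr
          linarith
        · have h4 : 2 * C + 2 ≤ (2 * C + 2) * X := le_mul_of_one_le_right (by positivity) hX1
          have h5 : 0 ≤ D * X := by positivity
          gcongr
          linarith
  · -- null output
    intro Q' hQ'
    obtain ⟨Q'', _, hQ''2⟩ := hopt Q' hQ'
    have h1 := hsaddle Q'' (hfeas Q'' hQ''2)
    -- If a feasible distribution existed, the saddle inequality against `Q''` would bound `B` times
    -- the violation by the range of sample disparities plus `2ν`, so the test would have been
    -- passed.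
    refine hif ?_
    rw [← sub_le_iff_le_add', le_div_iff₀ (hB0 ω), hweight]
    have h2 : (FairRashomon.mean Q (run ω).cost - (run ω).epsHat) * (run ω).B
        ≤ (run ω).B * max 0 (FairRashomon.mean Q (run ω).cost - (run ω).epsHat) := by
      rw [mul_comm]
      exact mul_le_mul_of_nonneg_left (le_max_right _ _) (hB0 ω).le
    have h3 := S.mean_empDisparity_sub_le N ω Q'' Q
    rw [← hdisp ω] at h3
    linarith
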